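/- Let $f\in C^2(\mathbb R)$, let $F'=f$, and put $V(u;a,c)=F(u)-\tfrac c2u^2-au$. Let $\mathcal D\subset\mathbb R^3$ be an open set of parameters $(a,E,c)$ on which there are continuous functions $u_-(a,E,c)<u_+(a,E,c)$ that are simple roots of $V(u;a,c)=E$, with $V(u;a,c)<E$ for $u\in(u_-,u_+)$. For $(a,E,c)\in\mathcal D$ define the period, mass and momentum $$T=2\int_{u_-}^{u_+}\frac{du}{\sqrt{2(E-V(u;a,c))}},\quad M=2\int_{u_-}^{u_+}\frac{u\,du}{\sqrt{2(E-V(u;a,c))}},\quad P=2\int_{u_-}^{u_+}\frac{u^2\,du}{\sqrt{2(E-V(u;a,c))}}.$$ For fixed $(a,E,c)\in\mathcal D$ let $u$ be the traveling wave profile, i.e. the solution of $u_{xx}+f(u)-cu=a$ on $\mathbb R$ with $u(0)=u_-(a,E,c)$, $u_x(0)=0$, and for $\mu\in\mathbb C$ let $\mathbf M(\mu)=\Phi(T(a,E,c);\mu)$ be the monodromy matrix, where $$\Phi_x=\begin{pmatrix}0&1&0\\0&0&1\\-\mu-u_xf''(u)&-f'(u)+c&0\end{pmatrix}\Phi,\qquad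 \Phi(0;\mu)=\mathbf I .$$ Write $\{g,h\}_{x,y}=\begin{vmatrix}g_x&h_x\\g_y&h_y\end{vmatrix}$, and let $\{g,h,k\}_{x,y,z}$ be the analogous $3\times3$ Jacobian determinant (rows indexed by the variables, columns by the functions). Then $T,M,P$ are differentiable at $(a,E,c)$, $\mathbf M$ is analytic at $\mu=0$, and $$\operatorname{tr}\mathbf M_{\mu\mu}(0)=\{T,P\}_{E,c}+2\{M,P\}_{a,E},\qquad \operatorname{tr}\mathbf M_{\mu\mu\mu}(0)=-\tfrac32\{T,M,P\}_{a,E,c}.$$ Consequently the modulational stability index $\Delta:=\tfrac12\big(\operatorname{tr}\mathbf M_{\mu\mu}(0)\big)^3-3\big(\operatorname{tr}\mathbf M_{\mu\mu\mu}(0)\big)^2$ equals $$\Delta=\tfrac12\big(\{T,P\}_{E,c}+2\{M,P\}_{a,E}\big)^3-3\big(\tfrac32\{T,M,P\}_{a,E,c}\big)^2 .$$ -/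

import Mathlib

noncomputable section

namespace GKdV

/-- The effective potential `V(u; a, c) = F(u) - (c/2) u² - a u`. -/
def potential (F : ℝ → ℝ) (a c : ℝ) (v : ℝ) : ℝ := F v - c / 2 * v ^ 2 - a * v

/-- `D` is an open set of parameters `(a, E, c)` on which the continuous functions
`uMinus < uPlus` are simple roots of `V(u; a, c) = E`, with `V(u; a, c) < E` strictly between
them: the turning points of a family of periodic traveling waves. -/
structure IsWaveRegion (F : ℝ → ℝ) (D : Set (ℝ × ℝ × ℝ)) (uMinus uPlus : ℝ → ℝ → ℝ → ℝ) :
    Prop where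
  isOpen : IsOpen D
  continuousOn_minus : ContinuousOn (fun p : ℝ × ℝ × ℝ => uMinus p.1 p.2.1 p.2.2) D
  continuousOn_plus : ContinuousOn (fun p : ℝ × ℝ × ℝ => uPlus p.1 p.2.1 p.2.2) D
  lt : ∀ a E c, (a, E, c) ∈ D → uMinus a E c < uPlus a E c
  root_minus : ∀ a E c, (a, E, c) ∈ D → potential F a c (uMinus a E c) = E
  root_plus : ∀ a E c, (a, E, c) ∈ D → potential F a c (uPlus a E c) = E
  below : ∀ a E c, (a, E, c) ∈ D →
    ∀ v ∈ Set.Ioo (uMinus a E c) (uPlus a E c), potential F a c v < E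
  simple_minus : ∀ a E c, (a, E, c) ∈ D → deriv (potential F a c) (uMinus a E c) ≠ 0
  simple_plus : ∀ a E c, (a, E, c) ∈ D → deriv (potential F a c) (uPlus a E c) ≠ 0

/-- The traveling wave profile: `u'' + f(u) - c u = a`, normalized by `u(0) = u₋`, `u'(0) = 0`. -/
structure IsWaveProfile (f : ℝ → ℝ) (a c uMin : ℝ) (u : ℝ → ℝ) : Prop where
  differentiable : Differentiable ℝ u
  differentiable_deriv : Differentiable ℝ (deriv u)
  equation : ∀ x, deriv (deriv u) x + f (u x) - c * u x = a
  init : u 0 = uMin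
  init_deriv : deriv u 0 = 0

/-- The period `T(a, E, c)`, an integral over one oscillation. -/
def period (F : ℝ → ℝ) (uMinus uPlus : ℝ → ℝ → ℝ → ℝ) (a E c : ℝ) : ℝ :=
  2 * ∫ v in (uMinus a E c)..(uPlus a E c), 1 / √(2 * (E - potential F a c v))

/-- The mass `M(a, E, c)`. -/
def mass (F : ℝ → ℝ) (uMinus uPlus : ℝ → ℝ → ℝ → ℝ) (a E c : ℝ) : ℝ :=
  2 * ∫ v in (uMinus a E c)..(uPlus a E c), v / √(2 * (E - potential F a c v))

/-- The momentum `P(a, E, c)`. -/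
def momentum (F : ℝ → ℝ) (uMinus uPlus : ℝ → ℝ → ℝ → ℝ) (a E c : ℝ) : ℝ :=
  2 * ∫ v in (uMinus a E c)..(uPlus a E c), v ^ 2 / √(2 * (E - potential F a c v))

/-- Partial derivative in `a` of a function of `(a, E, c)`. -/
def partialA (g : ℝ → ℝ → ℝ → ℝ) (a E c : ℝ) : ℝ := deriv (fun s => g s E c) a

/-- Partial derivative in `E` of a function of `(a, E, c)`. -/
def partialE (g : ℝ → ℝ → ℝ → ℝ) (a E c : ℝ) : ℝ := deriv (fun s => g a s c) E

/-- Partial derivative in `c` of a function of `(a, E, c)`. -/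
def partialC (g : ℝ → ℝ → ℝ → ℝ) (a E c : ℝ) : ℝ := deriv (fun s => g a E s) c

/-- `{g, h}_{x, y}`, where `∂x` and `∂y` are two of the partial derivatives above. -/
def jacobian₂ (dx dy : (ℝ → ℝ → ℝ → ℝ) → ℝ → ℝ → ℝ → ℝ) (g h : ℝ → ℝ → ℝ → ℝ)
    (a E c : ℝ) : ℝ :=
  Matrix.det !![dx g a E c, dx h a E c;
                dy g a E c, dy h a E c]

/-- `{g, h, k}_{x, y, z}`. -/
def jacobian₃ (dx dy dz : (ℝ → ℝ → ℝ → ℝ) → ℝ → ℝ → ℝ → ℝ) (g h k : ℝ → ℝ → ℝ → ℝ)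
    (a E c : ℝ) : ℝ :=
  Matrix.det !![dx g a E c, dx h a E c, dx k a E c;
                dy g a E c, dy h a E c, dy k a E c;
                dz g a E c, dz h a E c, dz k a E c]

/-- The coefficient matrix `H(x; μ)` of the first order system equivalent to
`v''' = -μ v - (f'(u) v)' + c v'`. -/
def coeffMatrix (f : ℝ → ℝ) (c : ℝ) (u : ℝ → ℝ) (μ : ℂ) (x : ℝ) : Matrix (Fin 3) (Fin 3) ℂ :=
  !![0, 1, 0;
     0, 0, 1;
     -μ - ((deriv u x * deriv (deriv f) (u x) : ℝ) : ℂ), ((-deriv f (u x) + c : ℝ) : ℂ), 0]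

/-- `Φ` is the matrix solution of `Φ' = A Φ`, `Φ(0) = I`. -/
def IsFundamentalMatrix (A Φ : ℝ → Matrix (Fin 3) (Fin 3) ℂ) : Prop :=
  Φ 0 = 1 ∧ ∀ x i j, HasDerivAt (fun y => Φ y i j) ((A x * Φ x) i j) x

/-- `Mono` is the monodromy (period map) `μ ↦ Φ(T; μ)`. -/
def IsMonodromy (f : ℝ → ℝ) (c : ℝ) (u : ℝ → ℝ) (T : ℝ)
    (Mono : ℂ → Matrix (Fin 3) (Fin 3) ℂ) : Prop :=
  ∀ μ, ∃ Φ, IsFundamentalMatrix (coeffMatrix f c u μ) Φ ∧ Mono μ = Φ T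

/-- The `k`-th derivative in `μ` of a matrix-valued function, at `μ = 0`. -/
def derivAtZero (k : ℕ) (Mono : ℂ → Matrix (Fin 3) (Fin 3) ℂ) : Matrix (Fin 3) (Fin 3) ℂ :=
  Matrix.of fun i j => iteratedDeriv k (fun μ => Mono μ i j) 0

/-- The modulational stability index
`Δ = ½ (tr M_μμ(0))³ - 3 (tr M_μμμ(0))²`. -/
def modulationalIndex (Mono : ℂ → Matrix (Fin 3) (Fin 3) ℂ) : ℂ :=
  1 / 2 * (derivAtZero 2 Mono).trace ^ 3 - 3 * (derivAtZero 3 Mono).trace ^ 2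

end GKdV

end

open GKdV

open Set Filter Topology MeasureTheory

/-! Put `k = f'(u) - c`. In the variables `(v, v', m)` with `m = -v'' - k v`, the spectral equation
becomes `m' = μ v`. At `μ = 0` its solutions are explicit: `u_x` solves it with `m = 0`, and the
derivatives of the wave in `a`, `E`, `c` solve `y'' + k y = 1`, `0`, `u`. Over one period the latter
return to their initial value, but since the period depends on the parameters their slopes jump by
`κ T_a`, `κ T_E`, `κ T_c`, where `κ = V'(u₋)`.

Let `N(μ)` be the monodromy in these variables. Its columns 0 and 2 start out, to leading order, as
combinations of `u_E` and `u_a`. Column 1 starts out as `-u_x / κ` and needs a correction of order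
`μ` built from all three variations. Two conservation laws (`IsOscillation.tendsto_column`) show
that `v` and `m` change only through `μ ∫ v` and `μ ∫ u v`. Hence `N - 1 = diag(μ, 1, μ) B(μ)
diag(1, μ, 1)`, where `B(μ)` tends to a matrix `A` made of derivatives of `T`, `M`, `P`.

This leading behaviour suffices because of two symmetries. The system is trace free, so `det N = 1`;
and a pairing between solutions at `μ` and `-μ` is conserved, so `tr N(-μ) = tr adj N(μ)`. With `t =
tr N`, expanding the characteristic polynomial at `1` gives `t(μ) - t(-μ) = det (N - 1) = μ³ det B`
and `t(-μ) - 2 t(μ) + 3 = tr adj (N - 1) = μ² tr adj B`. Thus `t''(0) = -2 tr adj A` and `t'''(0) =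
3 det A`. Green's identity between the variations supplies `M_E = T_a`, `P_E = 2 T_c`, `P_a = 2
M_c`, and the rest is algebra.

The analytic difficulty is that `T`, `M`, `P` are singular integrals with moving endpoints. Between
the roots `r < s` one has `E - V(w) = (w - r) (s - w) g` with `g` a positive `C¹` divided
difference. The substitution `w = r + sin² θ (s - r)` turns one oscillation into `θ ∈ [0, π]` and
the integrals into integrals of functions that are jointly `C¹` in `(r, s, c)` and `θ`. The
variations of the wave are computed in the same phase variable. -/

/-! ### The forced linear system: Grönwall bound and analytic dependence on `μ` -/

/-- `z = (v, v', m)` solves `m = -v'' - k v`, `m' = μ v + h` on `[0, L]`. -/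
def IsForcedSolution (k : ℝ → ℝ) (L : ℝ) (μ : ℂ) (h : ℝ → ℂ) (z : ℝ → Fin 3 → ℂ) : Prop :=
  ∀ x ∈ Icc 0 L, HasDerivAt z ![z x 1, -z x 2 - k x * z x 0, μ * z x 0 + h x] x

namespace IsForcedSolution

variable {k : ℝ → ℝ} {L : ℝ} {μ ν : ℂ} {h g : ℝ → ℂ} {z w : ℝ → Fin 3 → ℂ}

theorem hasDerivAt_zero (hz : IsForcedSolution k L μ h z) {x : ℝ} (hx : x ∈ Icc 0 L) :
    HasDerivAt (fun t => z t 0) (z x 1) x := by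
  simpa using hasDerivAt_pi.1 (hz x hx) 0

theorem hasDerivAt_one (hz : IsForcedSolution k L μ h z) {x : ℝ} (hx : x ∈ Icc 0 L) :
    HasDerivAt (fun t => z t 1) (-z x 2 - k x * z x 0) x := by
  simpa using hasDerivAt_pi.1 (hz x hx) 1

theorem hasDerivAt_two (hz : IsForcedSolution k L μ h z) {x : ℝ} (hx : x ∈ Icc 0 L) :
    HasDerivAt (fun t => z t 2) (μ * z x 0 + h x) x := by
  simpa using hasDerivAt_pi.1 (hz x hx) 2

theorem of_components (h0 : ∀ x ∈ Icc 0 L, HasDerivAt (fun t => z t 0) (z x 1) x)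
    (h1 : ∀ x ∈ Icc 0 L, HasDerivAt (fun t => z t 1) (-z x 2 - k x * z x 0) x)
    (h2 : ∀ x ∈ Icc 0 L, HasDerivAt (fun t => z t 2) (μ * z x 0 + h x) x) :
    IsForcedSolution k L μ h z := by
  intro x hx
  rw [hasDerivAt_pi]
  intro i
  fin_cases i
  · exact h0 x hx
  · exact h1 x hx
  · exact h2 x hx

theorem continuousOn (hz : IsForcedSolution k L μ h z) : ContinuousOn z (Icc 0 L) :=
  fun x hx => (hz x hx).continuousAt.continuousWithinAt

theorem sub (hz : IsForcedSolution k L μ h z) (hw : IsForcedSolution k L ν g w) :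
    IsForcedSolution k L μ (fun x => h x - g x + (μ - ν) * w x 0) (fun x => z x - w x) := by
  intro x hx
  refine ((hz x hx).sub (hw x hx)).congr_deriv ?_
  ext i
  fin_cases i <;> simp <;> ring

theorem const_smul (a : ℂ) (hz : IsForcedSolution k L μ h z) :
    IsForcedSolution k L μ (fun x => a * h x) (fun x => a • z x) := by
  intro x hx
  refine ((hz x hx).const_smul a).congr_deriv ?_
  ext i
  fin_cases i <;> simp <;> ring

theorem congr_forcing (hz : IsForcedSolution k L μ h z) (hg : ∀ x ∈ Icc 0 L, h x = g x) :
    IsForcedSolution k L μ g z := by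
  intro x hx
  rw [← hg x hx]
  exact hz x hx

/-- Grönwall's inequality for the forced system, uniformly for `μ` in a ball. -/
theorem exists_norm_le (hk : ContinuousOn k (Icc 0 L)) (R : ℝ) :
    ∃ C, 0 ≤ C ∧ ∀ (μ : ℂ) (h : ℝ → ℂ) (z : ℝ → Fin 3 → ℂ) (ε : ℝ), ‖μ‖ ≤ R → 0 ≤ ε →
      IsForcedSolution k L μ h z → (∀ x ∈ Icc 0 L, ‖h x‖ ≤ ε) →
      ∀ x ∈ Icc 0 L, ‖z x‖ ≤ C * (‖z 0‖ + ε) := by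
  obtain ⟨K₀, hK₀⟩ := isCompact_Icc.exists_bound_of_continuousOn hk
  -- The summand `1` accounts for the constant entries of the system, and makes `K ≥ 1`, so that `ε
  -- / K ≤ ε`.
  set K : ℝ := 1 + |K₀| + |R| with hK
  have hK1 : 1 ≤ K := by
    have := abs_nonneg K₀
    have := abs_nonneg R
    linarith
  refine ⟨Real.exp (K * L), (Real.exp_pos _).le, fun μ h z ε hμ hε hz hh x hx => ?_⟩
  have key := norm_le_gronwallBound_of_norm_deriv_right_le (δ := ‖z 0‖) (K := K) (ε := ε)
    hz.continuousOn (fun x hx => (hz x (Ico_subset_Icc_self hx)).hasDerivWithinAt) le_rfl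
    (fun t ht => ?_) x hx
  · refine key.trans ?_
    rw [gronwallBound_of_K_ne_0 (by positivity)]
    have he : Real.exp (K * (x - 0)) ≤ Real.exp (K * L) := by
      apply Real.exp_le_exp.2
      have := hx.2
      rw [sub_zero]
      gcongr
    have hdiv : ε / K ≤ ε := div_le_self hε hK1
    have hpos : 0 ≤ Real.exp (K * (x - 0)) - 1 := by
      have : 0 ≤ K * (x - 0) := by
        have := hx.1
        rw [sub_zero]
        positivity
      linarith [Real.one_le_exp this]
    have h1 : ‖z 0‖ * Real.exp (K * (x - 0)) ≤ ‖z 0‖ * Real.exp (K * L) := by gcongr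
    have h2 : ε / K * (Real.exp (K * (x - 0)) - 1) ≤ ε * Real.exp (K * L) :=
      mul_le_mul hdiv (by linarith) hpos hε
    linarith
  · have htI := Ico_subset_Icc_self ht
    have hn : ∀ i, ‖z t i‖ ≤ ‖z t‖ := fun i => norm_le_pi_norm _ i
    have hk' : |k t| ≤ |K₀| := (hK₀ t htI).trans (le_abs_self _)
    have hμ' : ‖μ‖ ≤ |R| := hμ.trans (le_abs_self _)
    have hz0 := norm_nonneg (z t)
    have e1 : ‖(k t : ℂ) * z t 0‖ ≤ |K₀| * ‖z t‖ := by
      rw [norm_mul, Complex.norm_real]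
      exact mul_le_mul hk' (hn 0) (norm_nonneg _) (abs_nonneg _)
    have e2 : ‖μ * z t 0‖ ≤ |R| * ‖z t‖ := by
      rw [norm_mul]
      exact mul_le_mul hμ' (hn 0) (norm_nonneg _) (abs_nonneg _)
    have e3 : 0 ≤ |K₀| * ‖z t‖ := by positivity
    have e4 : 0 ≤ |R| * ‖z t‖ := by positivity
    have hKz : K * ‖z t‖ = ‖z t‖ + |K₀| * ‖z t‖ + |R| * ‖z t‖ := by rw [hK]; ring
    rw [pi_norm_le_iff_of_nonneg (by positivity), hKz]
    intro i
    fin_cases i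
    · have := hn 1
      simp only [Fin.zero_eta, Matrix.cons_val_zero]
      linarith
    · have h1 : ‖-z t 2 - (k t : ℂ) * z t 0‖ ≤ ‖z t 2‖ + ‖(k t : ℂ) * z t 0‖ := by
        simpa using norm_sub_le (-z t 2) ((k t : ℂ) * z t 0)
      have := hn 2
      simp only [Fin.mk_one, Matrix.cons_val_one, Matrix.cons_val_zero]
      linarith
    · have h1 := norm_add_le (μ * z t 0) (h t)
      have := hh t htI
      simp only [Fin.reduceFinMk, Matrix.cons_val]
      linarith

/-- The value at `x` of the homogeneous solution with fixed initial data is entire in `μ`. -/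
theorem differentiable_parameter (hk : ContinuousOn k (Icc 0 L))
    {z : ℂ → ℝ → Fin 3 → ℂ} (hz : ∀ μ, IsForcedSolution k L μ 0 (z μ)) {e : Fin 3 → ℂ}
    (h0 : ∀ μ, z μ 0 = e) {x : ℝ} (hx : x ∈ Icc 0 L) : Differentiable ℂ (fun μ => z μ x) := by
  intro ν
  obtain ⟨C, hC, hbound⟩ := exists_norm_le hk (‖ν‖ + 1)
  have hball : ∀ μ ∈ Metric.closedBall ν 1, ‖μ‖ ≤ ‖ν‖ + 1 := fun μ hμ => by
    have h1 : ‖μ - ν‖ ≤ 1 := by simpa [dist_eq_norm] using hμ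
    have h2 := norm_add_le (μ - ν) ν
    rw [sub_add_cancel] at h2
    linarith
  have hb : ∀ μ ∈ Metric.closedBall ν 1, ∀ t ∈ Icc 0 L, ‖z μ t‖ ≤ C * ‖e‖ := by
    intro μ hμ t ht
    simpa [h0] using hbound μ 0 (z μ) 0 (hball μ hμ) le_rfl (hz μ) (by simp) t ht
  have hlip : ∀ μ ∈ Metric.closedBall ν 1, ∀ μ' ∈ Metric.closedBall ν 1, ∀ t ∈ Icc 0 L,
      ‖z μ t - z μ' t‖ ≤ C * (‖μ - μ'‖ * (C * ‖e‖)) := by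
    intro μ hμ μ' hμ' t ht
    have := hbound μ _ _ (‖μ - μ'‖ * (C * ‖e‖)) (hball μ hμ) (by positivity)
      ((hz μ).sub (hz μ')) (fun s hs => ?_) t ht
    · simpa [h0] using this
    · simp only [Pi.zero_apply, sub_self, zero_add, norm_mul]
      gcongr
      exact (norm_le_pi_norm _ 0).trans (hb μ' hμ' s hs)
  have hslope : ∀ μ ∈ Metric.closedBall ν 1, μ ≠ ν →
      IsForcedSolution k L ν (fun t => z μ t 0) (fun t => (μ - ν)⁻¹ • (z μ t - z ν t)) := by
    intro μ hμ hne
    have hne' : μ - ν ≠ 0 := sub_ne_zero.2 hne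
    -- Subtracting in this order keeps the fixed parameter `ν` in the equation, so the quotient is
    -- forced by `z μ` itself.
    have h1 := (((hz ν).sub (hz μ)).const_smul (-(μ - ν)⁻¹)).congr_forcing (g := fun t => z μ t 0)
      (fun t _ => by simp only [Pi.zero_apply]; field_simp; ring)
    have h2 : (fun t => -(μ - ν)⁻¹ • (z ν t - z μ t)) =
        fun t => (μ - ν)⁻¹ • (z μ t - z ν t) := by
      funext t
      rw [neg_smul, ← smul_neg, neg_sub]
    rwa [h2] at h1
  have hcauchy : ∀ μ ∈ Metric.closedBall ν 1, μ ≠ ν → ∀ μ' ∈ Metric.closedBall ν 1, μ' ≠ ν →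
      ‖(μ - ν)⁻¹ • (z μ x - z ν x) - (μ' - ν)⁻¹ • (z μ' x - z ν x)‖ ≤
        C * (C * (‖μ - μ'‖ * (C * ‖e‖))) := by
    intro μ hμ hne μ' hμ' hne'
    have := hbound ν _ _ (C * (‖μ - μ'‖ * (C * ‖e‖))) (by simp) (by positivity)
      ((hslope μ hμ hne).sub (hslope μ' hμ' hne')) (fun s hs => ?_) x hx
    · simpa [h0] using this
    · simp only [sub_self, zero_mul, add_zero]
      exact (norm_le_pi_norm (z μ s - z μ' s) 0).trans (hlip μ hμ μ' hμ' s hs)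
  -- The difference quotients are Cauchy: two of them solve the same equation at `ν` with forcings
  -- `z μ` and `z μ'`, which differ by `O(‖μ - μ'‖)`. No solution of the variational equation has to
  -- be exhibited as the limit.
  have hex : ∃ y, Tendsto (slope (fun μ => z μ x) ν) (𝓝[≠] ν) (𝓝 y) := by
    apply cauchy_map_iff_exists_tendsto.1
    rw [Metric.cauchy_iff]
    refine ⟨inferInstance, fun ε hε => ?_⟩
    set A := C * (C * (C * ‖e‖)) with hA
    have hA0 : 0 ≤ A := by positivity
    set δ := min 1 (ε / (4 * (A + 1))) with hδ
    have hδ0 : 0 < δ := by positivity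
    have hmem : Metric.closedBall ν δ ∩ {ν}ᶜ ∈ 𝓝[≠] ν :=
      inter_mem (mem_nhdsWithin_of_mem_nhds (Metric.closedBall_mem_nhds ν hδ0)) self_mem_nhdsWithin
    refine ⟨_, image_mem_map hmem, ?_⟩
    rintro _ ⟨μ, ⟨hμ, hne⟩, rfl⟩ _ ⟨μ', ⟨hμ', hne'⟩, rfl⟩
    have hsub := Metric.closedBall_subset_closedBall (x := ν) (min_le_left 1 (ε / (4 * (A + 1))))
    have h1 := hcauchy μ (hsub hμ) hne μ' (hsub hμ') hne'
    have h2 : ‖μ - μ'‖ ≤ 2 * δ := by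
      have h3 := dist_triangle_right μ μ' ν
      have h4 : dist μ ν ≤ δ := hμ
      have h5 : dist μ' ν ≤ δ := hμ'
      rw [← dist_eq_norm]
      linarith
    have h6 : δ ≤ ε / (4 * (A + 1)) := min_le_right _ _
    rw [dist_eq_norm, slope_def_module, slope_def_module]
    calc _ ≤ A * ‖μ - μ'‖ := by rw [hA]; linarith
      _ ≤ A * (2 * (ε / (4 * (A + 1)))) := by gcongr; linarith
      _ = (A / (A + 1)) * (ε / 2) := by field_simp; ring
      _ ≤ 1 * (ε / 2) := by
        gcongr
        rw [div_le_one (by positivity)]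
        linarith
      _ < ε := by linarith
  obtain ⟨y, hy⟩ := hex
  exact (hasDerivAt_iff_tendsto_slope.2 hy).differentiableAt

end IsForcedSolution

/-! ### Variations along one oscillation and small-`μ` asymptotics -/

/-- `y` solves `y'' + k y = α + γ u` on `[0, L]` with `y(0) = y(L) = ρ`, `y'(0) = 0`,
`y'(L) = τ`, `∫ y = I` and `∫ u y = J`. -/
structure IsVariation (k u : ℝ → ℝ) (L α γ ρ τ I J : ℝ) (y y' : ℝ → ℝ) : Prop where
  hasDerivAt : ∀ x ∈ Icc 0 L, HasDerivAt y (y' x) x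
  hasDerivAt' : ∀ x ∈ Icc 0 L, HasDerivAt y' (α + γ * u x - k x * y x) x
  left : y 0 = ρ
  left' : y' 0 = 0
  right : y L = ρ
  right' : y' L = τ
  integral : ∫ x in (0 : ℝ)..L, y x = I
  integral_mul : ∫ x in (0 : ℝ)..L, u x * y x = J

/-- `u` is, on `[0, L]`, one oscillation of a wave between turning points at height `r` with
`u'' = -κ` there, and `k` is the coefficient of the linearization along `u`. -/
structure IsOscillation (k u : ℝ → ℝ) (L r κ : ℝ) (u' u'' : ℝ → ℝ) : Prop where
  nonneg : 0 ≤ L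
  continuousOn : ContinuousOn k (Icc 0 L)
  hasDerivAt : ∀ x ∈ Icc 0 L, HasDerivAt u (u' x) x
  hasDerivAt' : ∀ x ∈ Icc 0 L, HasDerivAt u' (u'' x) x
  hasDerivAt'' : ∀ x ∈ Icc 0 L, HasDerivAt u'' (-k x * u' x) x
  left : u 0 = r
  right : u L = r
  left' : u' 0 = 0
  right' : u' L = 0
  left'' : u'' 0 = -κ
  right'' : u'' L = -κ
  ne_zero : κ ≠ 0

namespace IsVariation

variable {k u y y' w w' : ℝ → ℝ} {L α γ ρ τ I J α₂ γ₂ ρ₂ τ₂ I₂ J₂ : ℝ}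

theorem continuousOn (h : IsVariation k u L α γ ρ τ I J y y') : ContinuousOn y (Icc 0 L) :=
  fun x hx => (h.hasDerivAt x hx).continuousAt.continuousWithinAt

theorem linear_comb (hL : 0 ≤ L) (hu : ContinuousOn u (Icc 0 L))
    (h : IsVariation k u L α γ ρ τ I J y y') (h₂ : IsVariation k u L α₂ γ₂ ρ₂ τ₂ I₂ J₂ w w')
    (a b : ℝ) :
    IsVariation k u L (a * α + b * α₂) (a * γ + b * γ₂) (a * ρ + b * ρ₂) (a * τ + b * τ₂)
      (a * I + b * I₂) (a * J + b * J₂) (fun x => a * y x + b * w x)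
      (fun x => a * y' x + b * w' x) := by
  have i1 : IntervalIntegrable y volume 0 L :=
    ContinuousOn.intervalIntegrable (by rw [uIcc_of_le hL]; exact h.continuousOn)
  have i2 : IntervalIntegrable w volume 0 L :=
    ContinuousOn.intervalIntegrable (by rw [uIcc_of_le hL]; exact h₂.continuousOn)
  have i3 : IntervalIntegrable (fun x => u x * y x) volume 0 L :=
    ContinuousOn.intervalIntegrable (by rw [uIcc_of_le hL]; exact hu.mul h.continuousOn)
  have i4 : IntervalIntegrable (fun x => u x * w x) volume 0 L :=
    ContinuousOn.intervalIntegrable (by rw [uIcc_of_le hL]; exact hu.mul h₂.continuousOn)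
  refine ⟨fun x hx => ((h.hasDerivAt x hx).const_mul a).add ((h₂.hasDerivAt x hx).const_mul b),
    fun x hx => (((h.hasDerivAt' x hx).const_mul a).add
      ((h₂.hasDerivAt' x hx).const_mul b)).congr_deriv (by ring),
    by rw [h.left, h₂.left], by rw [h.left', h₂.left']; ring, by rw [h.right, h₂.right],
    by rw [h.right', h₂.right'], ?_, ?_⟩
  · rw [intervalIntegral.integral_add (i1.const_mul a) (i2.const_mul b),
      intervalIntegral.integral_const_mul, intervalIntegral.integral_const_mul, h.integral,
      h₂.integral]
  · rw [← h.integral_mul, ← h₂.integral_mul, ← intervalIntegral.integral_const_mul,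
      ← intervalIntegral.integral_const_mul,
      ← intervalIntegral.integral_add (i3.const_mul a) (i4.const_mul b)]
    congr 1
    funext x
    ring

/-- Green's identity for two variations. -/
theorem wronskian (hL : 0 ≤ L) (hu : ContinuousOn u (Icc 0 L))
    (h : IsVariation k u L α γ ρ τ I J y y') (h₂ : IsVariation k u L α₂ γ₂ ρ₂ τ₂ I₂ J₂ w w') :
    α₂ * I + γ₂ * J - α * I₂ - γ * J₂ = ρ * τ₂ - ρ₂ * τ := by
  have i1 : IntervalIntegrable y volume 0 L :=
    ContinuousOn.intervalIntegrable (by rw [uIcc_of_le hL]; exact h.continuousOn)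
  have i2 : IntervalIntegrable w volume 0 L :=
    ContinuousOn.intervalIntegrable (by rw [uIcc_of_le hL]; exact h₂.continuousOn)
  have i3 : IntervalIntegrable (fun x => u x * y x) volume 0 L :=
    ContinuousOn.intervalIntegrable (by rw [uIcc_of_le hL]; exact hu.mul h.continuousOn)
  have i4 : IntervalIntegrable (fun x => u x * w x) volume 0 L :=
    ContinuousOn.intervalIntegrable (by rw [uIcc_of_le hL]; exact hu.mul h₂.continuousOn)
  have hI : IntervalIntegrable
      (fun x => α₂ * y x + γ₂ * (u x * y x) - α * w x - γ * (u x * w x)) volume 0 L :=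
    (((i1.const_mul _).add (i3.const_mul _)).sub (i2.const_mul _)).sub (i4.const_mul _)
  have key := intervalIntegral.integral_eq_sub_of_hasDerivAt
    (f := fun x => y x * w' x - y' x * w x) (a := 0) (b := L) (fun x hx => ?_) hI
  · rw [intervalIntegral.integral_sub (((i1.const_mul _).add (i3.const_mul _)).sub
        (i2.const_mul _)) (i4.const_mul _),
      intervalIntegral.integral_sub ((i1.const_mul _).add (i3.const_mul _)) (i2.const_mul _),
      intervalIntegral.integral_add (i1.const_mul _) (i3.const_mul _)] at key
    simp only [intervalIntegral.integral_const_mul] at key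
    rw [h.integral, h₂.integral, h.integral_mul, h₂.integral_mul, h.right, h₂.right, h.right',
      h₂.right', h.left', h₂.left'] at key
    rw [key]
    ring
  · rw [uIcc_of_le hL] at hx
    exact (((h.hasDerivAt x hx).mul (h₂.hasDerivAt' x hx)).sub
      ((h.hasDerivAt' x hx).mul (h₂.hasDerivAt x hx))).congr_deriv (by ring)

end IsVariation

namespace IsOscillation

variable {k u u' u'' y y' : ℝ → ℝ} {L r κ α γ ρ τ I J b : ℝ} {n : ℕ}

theorem continuousOn_self (hu : IsOscillation k u L r κ u' u'') : ContinuousOn u (Icc 0 L) :=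
  fun x hx => (hu.hasDerivAt x hx).continuousAt.continuousWithinAt

theorem continuousOn_deriv (hu : IsOscillation k u L r κ u' u'') : ContinuousOn u' (Icc 0 L) :=
  fun x hx => (hu.hasDerivAt' x hx).continuousAt.continuousWithinAt

/-- The approximate solution `μ ↦ b u' + μⁿ y` of the linearized problem. -/
theorem approx (hu : IsOscillation k u L r κ u' u'')
    (hy : IsVariation k u L α γ ρ τ I J y y') {μ : ℂ} (hb : μ ^ n * γ + μ * b = 0) :
    IsForcedSolution k L μ (fun x => -μ ^ (n + 1) * y x) (fun x =>
      ![b * u' x + μ ^ n * y x, b * u'' x + μ ^ n * y' x, -μ ^ n * (α + γ * u x)]) := by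
  apply IsForcedSolution.of_components
  · intro x hx
    exact ((hu.hasDerivAt' x hx).ofReal_comp.const_mul (b : ℂ)).add
      ((hy.hasDerivAt x hx).ofReal_comp.const_mul (μ ^ n))
  · intro x hx
    refine (((hu.hasDerivAt'' x hx).ofReal_comp.const_mul (b : ℂ)).add
      ((hy.hasDerivAt' x hx).ofReal_comp.const_mul (μ ^ n))).congr_deriv ?_
    simp
    ring
  · intro x hx
    refine ((((hu.hasDerivAt x hx).ofReal_comp.const_mul (γ : ℂ)).const_add (α : ℂ)).const_mul
      (-μ ^ n)).congr_deriv ?_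
    simp
    linear_combination (-(u' x : ℂ)) * hb

/-- The initial data agree exactly and the approximate solution leaves only the residual `-μ ^ (n +
1) y`, so Grönwall's inequality gives an error of that order. -/
theorem norm_sub_approx_le (hu : IsOscillation k u L r κ u' u'')
    (hy : IsVariation k u L α γ ρ τ I J y y') (hb : ∀ μ : ℂ, μ ^ n * γ + μ * b = 0)
    {z : ℂ → ℝ → Fin 3 → ℂ} (hz : ∀ μ, IsForcedSolution k L μ 0 (z μ))
    (h0 : ∀ μ, z μ 0 = ![μ ^ n * ρ, -b * κ, -μ ^ n * (α + γ * r)]) :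
    ∃ C, 0 ≤ C ∧ ∀ μ, ‖μ‖ ≤ 1 → ∀ x ∈ Icc 0 L, ∀ i, ‖z μ x i -
      ![b * u' x + μ ^ n * y x, b * u'' x + μ ^ n * y' x, -μ ^ n * (α + γ * u x)] i‖ ≤
        C * ‖μ‖ ^ (n + 1) := by
  obtain ⟨C, hC, hbound⟩ := IsForcedSolution.exists_norm_le hu.continuousOn 1
  obtain ⟨Y, hY⟩ := isCompact_Icc.exists_bound_of_continuousOn hy.continuousOn
  refine ⟨C * |Y|, by positivity, fun μ hμ x hx i => ?_⟩
  have := hbound μ _ _ (‖μ‖ ^ (n + 1) * |Y|) hμ (by positivity)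
    ((hz μ).sub (hu.approx hy (hb μ))) (fun t ht => ?_) x hx
  · refine (norm_le_pi_norm _ i).trans (this.trans (le_of_eq ?_))
    have e0 : z μ 0 - ![(b : ℂ) * u' 0 + μ ^ n * y 0, b * u'' 0 + μ ^ n * y' 0,
        -μ ^ n * (α + γ * u 0)] = 0 := by
      rw [h0, hu.left, hu.left', hu.left'', hy.left, hy.left']
      ext i
      fin_cases i <;> simp
    rw [e0, norm_zero]
    ring
  · simp only [Pi.zero_apply, sub_self, zero_mul, add_zero, zero_sub, norm_neg, norm_mul, norm_pow,
      Complex.norm_real]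
    gcongr
    exact (hY t ht).trans (le_abs_self _)

theorem tendsto_of_norm_sub_le {C : ℝ} {f g : ℂ → ℂ} {l : ℂ}
    (h : ∀ μ, ‖μ‖ ≤ 1 → ‖f μ - g μ‖ ≤ C * ‖μ‖ ^ (n + 1)) (hg : ∀ μ, g μ = μ ^ n * l) :
    Tendsto (fun μ => f μ / μ ^ n) (𝓝[≠] 0) (𝓝 l) := by
  rw [tendsto_iff_norm_sub_tendsto_zero]
  have h1 : Tendsto (fun μ : ℂ => C * ‖μ‖) (𝓝[≠] 0) (𝓝 0) := by
    have : Tendsto (fun μ : ℂ => C * ‖μ‖) (𝓝 0) (𝓝 (C * ‖(0 : ℂ)‖)) :=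
      (continuous_const.mul continuous_norm).tendsto 0
    rw [norm_zero, mul_zero] at this
    exact this.mono_left nhdsWithin_le_nhds
  have hball : Metric.closedBall (0 : ℂ) 1 ∈ 𝓝[≠] (0 : ℂ) :=
    mem_nhdsWithin_of_mem_nhds (Metric.closedBall_mem_nhds _ one_pos)
  refine squeeze_zero' (Eventually.of_forall fun _ => norm_nonneg _) ?_ h1
  filter_upwards [hball, self_mem_nhdsWithin] with μ hμ hne
  have hne' : μ ≠ 0 := hne
  have hμ1 : ‖μ‖ ≤ 1 := by simpa using hμ
  have e : f μ / μ ^ n - l = (f μ - g μ) / μ ^ n := by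
    rw [hg]
    field_simp
  rw [e, norm_div, norm_pow, div_le_iff₀ (by positivity)]
  calc _ ≤ _ := h μ hμ1
    _ = _ := by ring

/-- Leading behaviour, as `μ → 0`, of the change over one oscillation of a solution of the
linearized problem that starts out as `b u' + μⁿ y`. -/
theorem tendsto_column (hu : IsOscillation k u L r κ u' u'')
    (hy : IsVariation k u L α γ ρ τ I J y y') (hb : ∀ μ : ℂ, μ ^ n * γ + μ * b = 0)
    {z : ℂ → ℝ → Fin 3 → ℂ} (hz : ∀ μ, IsForcedSolution k L μ 0 (z μ))
    (h0 : ∀ μ, z μ 0 = ![μ ^ n * ρ, -b * κ, -μ ^ n * (α + γ * r)]) :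
    Tendsto (fun μ => (z μ L 0 - z μ 0 0) / μ / μ ^ n) (𝓝[≠] 0) (𝓝 ((J - r * I) / κ : ℝ)) ∧
    Tendsto (fun μ => (z μ L 1 - z μ 0 1) / μ ^ n) (𝓝[≠] 0) (𝓝 (τ : ℝ)) ∧
    Tendsto (fun μ => (z μ L 2 - z μ 0 2) / μ / μ ^ n) (𝓝[≠] 0) (𝓝 (I : ℝ)) := by
  have hL := hu.nonneg
  obtain ⟨C, hC, hbound⟩ := hu.norm_sub_approx_le hy hb hz h0
  obtain ⟨U, hU⟩ := isCompact_Icc.exists_bound_of_continuousOn hu.continuousOn_self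
  have hLmem : L ∈ Icc 0 L := right_mem_Icc.2 hL
  have cz : ∀ μ, ContinuousOn (fun x => z μ x 0) (Icc 0 L) := fun μ x hx =>
    ((hz μ).hasDerivAt_zero hx).continuousAt.continuousWithinAt
  have cu : ContinuousOn (fun x => (u x : ℂ)) (Icc 0 L) :=
    Complex.continuous_ofReal.comp_continuousOn hu.continuousOn_self
  have cu' : ContinuousOn (fun x => (u' x : ℂ)) (Icc 0 L) :=
    Complex.continuous_ofReal.comp_continuousOn hu.continuousOn_deriv
  have cy : ContinuousOn (fun x => (y x : ℂ)) (Icc 0 L) :=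
    Complex.continuous_ofReal.comp_continuousOn hy.continuousOn
  have ii : ∀ {f : ℝ → ℂ}, ContinuousOn f (Icc 0 L) → IntervalIntegrable f volume 0 L :=
    fun hf => ContinuousOn.intervalIntegrable (by rwa [uIcc_of_le hL])
  have cuz : ∀ μ, ContinuousOn (fun x => (u x : ℂ) * z μ x 0) (Icc 0 L) := fun μ => cu.mul (cz μ)
  have cuu : ContinuousOn (fun x => (u x : ℂ) * u' x) (Icc 0 L) := cu.mul cu'
  have cuy : ContinuousOn (fun x => (u x : ℂ) * y x) (Icc 0 L) := cu.mul cy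
  have ca : ∀ μ : ℂ, ContinuousOn (fun x => (b * u' x + μ ^ n * y x : ℂ)) (Icc 0 L) := fun μ =>
    (continuousOn_const.mul cu').add (continuousOn_const.mul cy)
  have cua : ∀ μ : ℂ, ContinuousOn (fun x => (u x * (b * u' x + μ ^ n * y x) : ℂ)) (Icc 0 L) :=
    fun μ => cu.mul (ca μ)
  -- the two conservation laws
  have c2 : ∀ μ, z μ L 2 - z μ 0 2 = μ * ∫ x in (0 : ℝ)..L, z μ x 0 := by
    intro μ
    rw [← intervalIntegral.integral_const_mul]
    refine (intervalIntegral.integral_eq_sub_of_hasDerivAt (f := fun x => z μ x 2)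
      (fun x hx => ?_) (ii (continuousOn_const.mul (cz μ)))).symm
    rw [uIcc_of_le hL] at hx
    simpa using (hz μ).hasDerivAt_two hx
  have c0 : ∀ μ, r * (z μ L 2 - z μ 0 2) + κ * (z μ L 0 - z μ 0 0) =
      μ * ∫ x in (0 : ℝ)..L, u x * z μ x 0 := by
    intro μ
    rw [← intervalIntegral.integral_const_mul]
    -- The quantity `u m + u' v' - u'' v` has derivative `μ u v`, the terms in `k` cancelling
    -- because `u''' = -k u'`. At both ends `u = r`, `u' = 0` and `u'' = -κ`, which leaves `r m + κ
    -- v`.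
    rw [intervalIntegral.integral_eq_sub_of_hasDerivAt
      (f := fun x => (u x : ℂ) * z μ x 2 + u' x * z μ x 1 - u'' x * z μ x 0)
      (fun x hx => ?_) ((ii (cuz μ)).const_mul μ)]
    · rw [hu.left, hu.right, hu.left', hu.right', hu.left'', hu.right'']
      push_cast
      ring
    · rw [uIcc_of_le hL] at hx
      refine ((((hu.hasDerivAt x hx).ofReal_comp.mul ((hz μ).hasDerivAt_two hx)).add
        ((hu.hasDerivAt' x hx).ofReal_comp.mul ((hz μ).hasDerivAt_one hx))).sub
        ((hu.hasDerivAt'' x hx).ofReal_comp.mul ((hz μ).hasDerivAt_zero hx))).congr_deriv ?_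
      simp
      ring
  -- As `u'` and `u u'` integrate to zero, the part `b u'` drops out and both integrals start at
  -- order `μ ^ n`. The factor `μ` of the conservation laws then gives the changes of `v` and `m` at
  -- order `n + 1`, which the pointwise error bound alone cannot resolve.
  have hu0 : ∫ x in (0 : ℝ)..L, (u' x : ℂ) = 0 := by
    rw [intervalIntegral.integral_eq_sub_of_hasDerivAt (f := fun x => (u x : ℂ))
      (fun x hx => ?_) (ii cu'), hu.left, hu.right, sub_self]
    rw [uIcc_of_le hL] at hx
    exact (hu.hasDerivAt x hx).ofReal_comp
  have huu : ∫ x in (0 : ℝ)..L, (u x : ℂ) * u' x = 0 := by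
    rw [intervalIntegral.integral_eq_sub_of_hasDerivAt (f := fun x => (u x : ℂ) * u x / 2)
      (fun x hx => ?_) (ii cuu), hu.left, hu.right, sub_self]
    rw [uIcc_of_le hL] at hx
    exact (((hu.hasDerivAt x hx).ofReal_comp.mul (hu.hasDerivAt x hx).ofReal_comp).div_const
      2).congr_deriv (by ring)
  have hI : ∫ x in (0 : ℝ)..L, (y x : ℂ) = I := by
    rw [intervalIntegral.integral_ofReal, hy.integral]
  have hJ : ∫ x in (0 : ℝ)..L, (u x : ℂ) * y x = J := by
    rw [← hy.integral_mul, ← intervalIntegral.integral_ofReal]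
    push_cast
    rfl
  have hsub : uIoc 0 L ⊆ Icc 0 L := by
    rw [uIoc_of_le hL]
    exact Ioc_subset_Icc_self
  have tI : Tendsto (fun μ => (∫ x in (0 : ℝ)..L, z μ x 0) / μ ^ n) (𝓝[≠] 0) (𝓝 (I : ℂ)) := by
    refine tendsto_of_norm_sub_le (C := C * L)
      (g := fun μ => ∫ x in (0 : ℝ)..L, (b * u' x + μ ^ n * y x : ℂ)) (fun μ hμ => ?_)
      (fun μ => ?_)
    · rw [← intervalIntegral.integral_sub (ii (cz μ)) (ii (ca μ))]
      refine (intervalIntegral.norm_integral_le_of_norm_le_const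
        (C := C * ‖μ‖ ^ (n + 1)) fun x hx => ?_).trans (le_of_eq ?_)
      · simpa using hbound μ hμ x (hsub hx) 0
      · rw [sub_zero, abs_of_nonneg hL]
        ring
    · rw [intervalIntegral.integral_add ((ii cu').const_mul _)
        ((ii cy).const_mul _), intervalIntegral.integral_const_mul,
        intervalIntegral.integral_const_mul, hu0, hI]
      ring
  have tJ : Tendsto (fun μ => (∫ x in (0 : ℝ)..L, u x * z μ x 0) / μ ^ n) (𝓝[≠] 0)
      (𝓝 (J : ℂ)) := by
    refine tendsto_of_norm_sub_le (C := |U| * C * L)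
      (g := fun μ => ∫ x in (0 : ℝ)..L, (u x * (b * u' x + μ ^ n * y x) : ℂ)) (fun μ hμ => ?_)
      (fun μ => ?_)
    · rw [← intervalIntegral.integral_sub (ii (cuz μ)) (ii (cua μ))]
      refine (intervalIntegral.norm_integral_le_of_norm_le_const
        (C := |U| * (C * ‖μ‖ ^ (n + 1))) fun x hx => ?_).trans (le_of_eq ?_)
      · rw [← mul_sub, norm_mul, Complex.norm_real]
        have h1 : ‖u x‖ ≤ |U| := (hU x (hsub hx)).trans (le_abs_self _)
        have h2 := hbound μ hμ x (hsub hx) 0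
        simp only [Matrix.cons_val_zero] at h2
        gcongr
      · rw [sub_zero, abs_of_nonneg hL]
        ring
    · have e : ∀ x, (u x * (b * u' x + μ ^ n * y x) : ℂ) =
          b * (u x * u' x) + μ ^ n * (u x * y x) := fun x => by ring
      simp only [e]
      rw [intervalIntegral.integral_add ((ii cuu).const_mul _)
        ((ii cuy).const_mul _), intervalIntegral.integral_const_mul,
        intervalIntegral.integral_const_mul, huu, hJ]
      ring
  have hκ : (κ : ℂ) ≠ 0 := Complex.ofReal_ne_zero.2 hu.ne_zero
  refine ⟨?_, ?_, ?_⟩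
  · have := (tJ.sub (tI.const_mul (r : ℂ))).div_const (κ : ℂ)
    push_cast
    refine this.congr' ?_
    filter_upwards [self_mem_nhdsWithin] with μ hμ
    have hμ' : μ ≠ 0 := hμ
    have e0 : z μ L 0 - z μ 0 0 = (μ * (∫ x in (0 : ℝ)..L, u x * z μ x 0) -
        r * (μ * ∫ x in (0 : ℝ)..L, z μ x 0)) / κ := by
      rw [← c0, ← c2]
      field_simp
      ring
    rw [e0]
    field_simp
  · refine tendsto_of_norm_sub_le (C := C) (g := fun μ => μ ^ n * τ) (fun μ hμ => ?_)
      (fun μ => rfl)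
    have := hbound μ hμ L hLmem 1
    simp only [Matrix.cons_val_one, Matrix.cons_val_zero, hu.right'', hy.right'] at this
    rw [h0]
    simp only [Matrix.cons_val_one, Matrix.cons_val_zero]
    convert this using 2
    push_cast
    ring
  · refine tI.congr' ?_
    filter_upwards [self_mem_nhdsWithin] with μ hμ
    have hμ' : μ ≠ 0 := hμ
    rw [c2]
    field_simp

end IsOscillation

/-! ### Symmetries of the monodromy and the Taylor coefficients of its trace -/

/-- The second and third derivatives at `0` of an analytic function, read off from the leading
behaviour of two combinations of its values at `μ` and `-μ`. -/
theorem AnalyticAt.iteratedDeriv_two_three_of_tendsto {a : ℂ → ℂ} (ha : AnalyticAt ℂ a 0)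
    {c d e : ℂ} (hd : Tendsto (fun μ => (a μ - a (-μ)) / μ ^ 3) (𝓝[≠] 0) (𝓝 d))
    (he : Tendsto (fun μ => (a (-μ) - 2 * a μ + c) / μ ^ 2) (𝓝[≠] 0) (𝓝 e)) :
    iteratedDeriv 2 a 0 = -2 * e ∧ iteratedDeriv 3 a 0 = 3 * d := by
  have hO := ha.hasFPowerSeriesAt.isBigO_sub_partialSum_pow 4
  simp only [FormalMultilinearSeries.partialSum, Finset.sum_range_succ, Finset.range_zero,
    Finset.sum_empty, FormalMultilinearSeries.ofScalars_apply_eq, zero_add, pow_zero, pow_one,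
    Nat.factorial, smul_eq_mul, Nat.cast_one, Nat.cast_mul, Nat.cast_ofNat, div_one, mul_one,
    iteratedDeriv_zero, Nat.succ_eq_add_one, Nat.reduceAdd] at hO
  set a₁ := iteratedDeriv 1 a 0
  set a₂ := iteratedDeriv 2 a 0
  set a₃ := iteratedDeriv 3 a 0
  set R : ℂ → ℂ := fun y => a y - (a 0 + a₁ * y + a₂ / 2 * y ^ 2 + a₃ / 6 * y ^ 3) with hR
  have hRO : R =O[𝓝 0] fun y => y ^ 4 := by
    refine (hO.congr_left fun y => ?_).trans (Asymptotics.isBigO_of_le _ fun y => by simp)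
    simp only [hR]
    ring
  have hR3 : Tendsto (fun y => R y / y ^ 3) (𝓝[≠] 0) (𝓝 0) :=
    ((hRO.trans_isLittleO (Asymptotics.isLittleO_pow_pow (by norm_num))).tendsto_div_nhds_zero).mono_left
      nhdsWithin_le_nhds
  have hneg : Tendsto (fun y : ℂ => -y) (𝓝[≠] 0) (𝓝[≠] 0) := by
    refine tendsto_nhdsWithin_iff.2 ⟨?_, ?_⟩
    · have : Tendsto (fun y : ℂ => -y) (𝓝 0) (𝓝 (-0)) := continuous_neg.tendsto 0
      rw [neg_zero] at this
      exact this.mono_left nhdsWithin_le_nhds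
    · filter_upwards [self_mem_nhdsWithin] with y hy
      simpa using hy
  have hR3' := hR3.comp hneg
  have hid : Tendsto (fun y : ℂ => y) (𝓝[≠] 0) (𝓝 0) := tendsto_id.mono_left nhdsWithin_le_nhds
  have ea : ∀ y, a y = a 0 + a₁ * y + a₂ / 2 * y ^ 2 + a₃ / 6 * y ^ 3 + R y := fun y => by
    simp only [hR]
    ring
  have ea' : ∀ y, a (-y) = a 0 - a₁ * y + a₂ / 2 * y ^ 2 - a₃ / 6 * y ^ 3 + R (-y) := fun y => by
    simp only [hR]
    ring
  -- The mere existence of the limits forces the lower coefficients: `a₁ = 0` here, and `a 0 = c`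
  -- below.
  have h1 : a₁ = 0 := by
    have t1 := (((hid.pow 2).mul hd).sub ((hid.pow 2).mul (hR3.add hR3'))).sub
      ((hid.pow 2).mul_const (a₃ / 3))
    have t2 : Tendsto (fun _ : ℂ => 2 * a₁) (𝓝[≠] 0) (𝓝 0) := by
      simp only [zero_mul, ne_eq, OfNat.ofNat_ne_zero, not_false_eq_true, zero_pow, sub_zero] at t1
      refine t1.congr' ?_
      filter_upwards [self_mem_nhdsWithin] with y hy
      have hy' : y ≠ 0 := hy
      simp only [Function.comp_apply]
      rw [ea y, ea' y]
      field_simp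
      ring
    have := tendsto_nhds_unique t2 tendsto_const_nhds
    simpa using this.symm
  have h3 : a₃ = 3 * d := by
    have t1 := hd.sub (hR3.add hR3')
    have t2 : Tendsto (fun _ : ℂ => a₃ / 3) (𝓝[≠] 0) (𝓝 d) := by
      simp only [add_zero, sub_zero] at t1
      refine t1.congr' ?_
      filter_upwards [self_mem_nhdsWithin] with y hy
      have hy' : y ≠ 0 := hy
      simp only [Function.comp_apply]
      rw [ea y, ea' y, h1]
      field_simp
      ring
    rw [tendsto_nhds_unique t2 tendsto_const_nhds]
    ring
  have h0 : c - a 0 = 0 := by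
    have t1 := ((hid.pow 2).mul he).add ((hid.pow 3).mul ((hR3.const_mul 2).add hR3'))
    have t3 := (t1.add ((hid.pow 2).mul_const (a₂ / 2))).add ((hid.pow 3).mul_const (a₃ / 2))
    have t2 : Tendsto (fun _ : ℂ => c - a 0) (𝓝[≠] 0) (𝓝 0) := by
      simp only [zero_mul, ne_eq, OfNat.ofNat_ne_zero, not_false_eq_true, zero_pow,
        add_zero] at t3
      refine t3.congr' ?_
      filter_upwards [self_mem_nhdsWithin] with y hy
      have hy' : y ≠ 0 := hy
      simp only [Function.comp_apply]
      rw [ea y, ea' y, h1]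
      field_simp
      ring
    exact tendsto_nhds_unique tendsto_const_nhds t2
  have h2 : a₂ = -2 * e := by
    have t1 := (he.add (hid.mul ((hR3.const_mul 2).add hR3'))).add (hid.mul_const (a₃ / 2))
    have t2 : Tendsto (fun _ : ℂ => -(a₂ / 2)) (𝓝[≠] 0) (𝓝 e) := by
      simp only [zero_mul, add_zero] at t1
      refine t1.congr' ?_
      filter_upwards [self_mem_nhdsWithin] with y hy
      have hy' : y ≠ 0 := hy
      simp only [Function.comp_apply]
      rw [ea y, ea' y, h1, sub_eq_zero.1 h0]
      field_simp
      ring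
    have h4 : -(a₂ / 2) = e := tendsto_nhds_unique tendsto_const_nhds t2
    linear_combination -2 * h4
  exact ⟨h2, h3⟩

/-- The value at `x` of the fundamental matrix with columns `z j`. -/
def columnMatrix (z : Fin 3 → ℝ → Fin 3 → ℂ) (x : ℝ) : Matrix (Fin 3) (Fin 3) ℂ :=
  Matrix.of fun i j => z j x i

/-- The columns `z j` form the fundamental solution of the homogeneous system. -/
structure IsFundamentalSystem (k : ℝ → ℝ) (L : ℝ) (μ : ℂ) (z : Fin 3 → ℝ → Fin 3 → ℂ) : Prop where
  solution : ∀ j, IsForcedSolution k L μ 0 (z j)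
  init : columnMatrix z 0 = 1

theorem eq_of_hasDerivAt_zero {L : ℝ} (hL : 0 ≤ L) {f : ℝ → ℂ}
    (h : ∀ x ∈ Icc 0 L, HasDerivAt f 0 x) : f L = f 0 :=
  constant_of_has_deriv_right_zero (fun x hx => (h x hx).continuousAt.continuousWithinAt)
    (fun x hx => (h x (Ico_subset_Icc_self hx)).hasDerivWithinAt) L (right_mem_Icc.2 hL)

namespace IsFundamentalSystem

variable {k : ℝ → ℝ} {L : ℝ} {μ : ℂ} {z w : Fin 3 → ℝ → Fin 3 → ℂ}

/-- Liouville's formula: the coefficient matrix of `(v, v', m)` has zero diagonal. -/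
theorem det_eq_one (hL : 0 ≤ L) (hz : IsFundamentalSystem k L μ z) :
    (columnMatrix z L).det = 1 := by
  rw [← Matrix.det_one (R := ℂ) (n := Fin 3), ← hz.init]
  refine eq_of_hasDerivAt_zero hL (f := fun x => (columnMatrix z x).det) fun x hx => ?_
  simp only [Matrix.det_fin_three, columnMatrix, Matrix.of_apply]
  have a0 := fun j => (hz.solution j).hasDerivAt_zero hx
  have a1 := fun j => (hz.solution j).hasDerivAt_one hx
  have a2 := fun j => (hz.solution j).hasDerivAt_two hx
  refine (((((((a0 0).mul (a1 1)).mul (a2 2)).sub (((a0 0).mul (a1 2)).mul (a2 1))).sub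
    (((a0 1).mul (a1 0)).mul (a2 2))).add (((a0 1).mul (a1 2)).mul (a2 0))).add
    (((a0 2).mul (a1 0)).mul (a2 1))).sub (((a0 2).mul (a1 1)).mul (a2 0)) |>.congr_deriv ?_
  simp only [Pi.zero_apply, Pi.mul_apply, add_zero]
  ring

/-- The skew pairing of a solution at `μ` with a solution at `-μ` is conserved. -/
theorem pairing (hL : 0 ≤ L) (hz : IsFundamentalSystem k L μ z)
    (hw : IsFundamentalSystem k L (-μ) w) :
    (columnMatrix w L).transpose * !![0, -μ, 0; μ, 0, 0; 0, 0, 1] * columnMatrix z L =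
      !![0, -μ, 0; μ, 0, 0; 0, 0, 1] := by
  have h0 : (columnMatrix w 0).transpose * !![0, -μ, 0; μ, 0, 0; 0, 0, 1] * columnMatrix z 0 =
      !![0, -μ, 0; μ, 0, 0; 0, 0, 1] := by
    rw [hz.init, hw.init]
    simp
  refine Eq.trans ?_ h0
  ext i j
  refine eq_of_hasDerivAt_zero hL (f := fun x => ((columnMatrix w x).transpose *
    !![0, -μ, 0; μ, 0, 0; 0, 0, 1] * columnMatrix z x) i j) fun x hx => ?_
  have e : (fun x => ((columnMatrix w x).transpose *
      !![0, -μ, 0; μ, 0, 0; 0, 0, 1] * columnMatrix z x) i j) = fun x =>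
      w i x 2 * z j x 2 + μ * (w i x 1 * z j x 0) - μ * (w i x 0 * z j x 1) := by
    funext x
    simp [Matrix.mul_apply, Fin.sum_univ_three, columnMatrix]
    ring
  rw [e]
  have a0 := (hz.solution j).hasDerivAt_zero hx
  have a1 := (hz.solution j).hasDerivAt_one hx
  have a2 := (hz.solution j).hasDerivAt_two hx
  have b0 := (hw.solution i).hasDerivAt_zero hx
  have b1 := (hw.solution i).hasDerivAt_one hx
  have b2 := (hw.solution i).hasDerivAt_two hx
  -- The derivative of `w₂ z₂` is `μ (w₂ z₀ - w₀ z₂)`, and that of `w₁ z₀ - w₀ z₁` is `w₀ z₂ - w₂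
  -- z₀`, the terms in `k` cancelling.
  refine ((b2.mul a2).add ((b1.mul a0).const_mul μ)).sub ((b0.mul a1).const_mul μ)
    |>.congr_deriv ?_
  simp only [Pi.zero_apply, add_zero]
  ring

/-- The monodromy at `μ` is conjugate to the inverse of the monodromy at `-μ`. -/
theorem trace_eq (hL : 0 ≤ L) (hμ : μ ≠ 0) (hz : IsFundamentalSystem k L μ z)
    (hw : IsFundamentalSystem k L (-μ) w) :
    (columnMatrix z L).trace = (columnMatrix w L).adjugate.trace := by
  have h := hz.pairing hL hw
  have hd := hw.det_eq_one hL
  set N := columnMatrix z L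
  set M := columnMatrix w L
  set S : Matrix (Fin 3) (Fin 3) ℂ := !![0, -μ, 0; μ, 0, 0; 0, 0, 1] with hS
  have hSdet : IsUnit S.det := by
    rw [hS, Matrix.det_fin_three]
    simpa using hμ
  have h1 : S * N = M.adjugate.transpose * S := by
    have h2 := congrArg (fun X => M.transpose.adjugate * X) h
    simp only [← mul_assoc, Matrix.adjugate_mul, Matrix.det_transpose, hd, one_smul,
      one_mul] at h2
    rw [h2, Matrix.adjugate_transpose]
  have h3 : N = S⁻¹ * (M.adjugate.transpose * S) := by
    rw [← h1, ← mul_assoc, Matrix.nonsing_inv_mul _ hSdet, one_mul]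
  rw [h3, Matrix.trace_mul_comm, mul_assoc, Matrix.mul_nonsing_inv _ hSdet, mul_one,
    Matrix.trace_transpose]

end IsFundamentalSystem

/-- The characteristic polynomial at `1`. For the monodromy the right side is the difference of the
traces at `μ` and `-μ`, so it isolates the odd Taylor coefficients. -/
theorem Matrix.det_sub_one_fin_three {N : Matrix (Fin 3) (Fin 3) ℂ} (h : N.det = 1) :
    (N - 1).det = N.trace - N.adjugate.trace := by
  simp only [Matrix.det_fin_three, Matrix.trace_fin_three, Matrix.adjugate_fin_three,
    Matrix.sub_apply, Matrix.one_apply_eq, Matrix.of_apply, Matrix.cons_val, Fin.isValue, ne_eq,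
    Fin.reduceEq, not_false_eq_true, Matrix.one_apply_ne] at h ⊢
  linear_combination h

/-- The companion identity for the sum of principal `2 × 2` minors, which gives access to the second
Taylor coefficient. -/
theorem Matrix.trace_adjugate_sub_one_fin_three (N : Matrix (Fin 3) (Fin 3) ℂ) :
    (N - 1).adjugate.trace = N.adjugate.trace - 2 * N.trace + 3 := by
  simp [Matrix.trace_fin_three, Matrix.adjugate_fin_three]
  ring

/-! ### Trace derivatives in terms of variations -/

namespace IsOscillation

variable {k u u' u'' ya ya' ye ye' yc yc' : ℝ → ℝ} {L r κ Ta Te Tc Ia Ie Ic Ja Je Jc : ℝ}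

/-- The derivatives at `μ = 0` of the trace of the monodromy, in terms of the variations of the
wave in its three parameters. -/
theorem iteratedDeriv_trace (hu : IsOscillation k u L r κ u' u'')
    (ha : IsVariation k u L 1 0 (r / κ) (κ * Ta) Ia Ja ya ya')
    (he : IsVariation k u L 0 0 (1 / κ) (κ * Te) Ie Je ye ye')
    (hc : IsVariation k u L 0 1 (r ^ 2 / (2 * κ)) (κ * Tc) Ic Jc yc yc')
    {z : ℂ → Fin 3 → ℝ → Fin 3 → ℂ} (hz : ∀ μ, IsFundamentalSystem k L μ (z μ)) :
    (∀ i j, Differentiable ℂ fun μ => columnMatrix (z μ) L i j) ∧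
    ∀ A : Matrix (Fin 3) (Fin 3) ℝ,
      A = !![Je - r * Ie, ((Jc - r * Ja + r ^ 2 / 2 * Je) - r * (Ic - r * Ia + r ^ 2 / 2 * Ie)) /
              κ ^ 2, ((-Ja + r * Je) - r * (-Ia + r * Ie)) / κ;
            κ ^ 2 * Te, Tc - r * Ta + r ^ 2 / 2 * Te, κ * (-Ta + r * Te);
            κ * Ie, (Ic - r * Ia + r ^ 2 / 2 * Ie) / κ, -Ia + r * Ie] →
      iteratedDeriv 2 (fun μ => (columnMatrix (z μ) L).trace) 0 =
        ((-2 * A.adjugate.trace : ℝ) : ℂ) ∧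
      iteratedDeriv 3 (fun μ => (columnMatrix (z μ) L).trace) 0 = ((3 * A.det : ℝ) : ℂ) := by
  have hL := hu.nonneg
  have hκ := hu.ne_zero
  have hκ' : (κ : ℂ) ≠ 0 := Complex.ofReal_ne_zero.2 hκ
  have cu := hu.continuousOn_self
  have hsol : ∀ j μ, IsForcedSolution k L μ 0 (z μ j) := fun j μ => (hz μ).solution j
  have hinit : ∀ j μ i, z μ j 0 i = (1 : Matrix (Fin 3) (Fin 3) ℂ) i j := fun j μ i => by
    rw [← (hz μ).init]
    rfl
  have hinit' : ∀ j μ, z μ j 0 = fun i => (1 : Matrix (Fin 3) (Fin 3) ℂ) i j := fun j μ =>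
    funext (hinit j μ)
  have hdiff : ∀ i j, Differentiable ℂ fun μ => columnMatrix (z μ) L i j := fun i j =>
    differentiable_pi.1 (IsForcedSolution.differentiable_parameter hu.continuousOn (hsol j)
      (hinit' j) (right_mem_Icc.2 hL)) i
  refine ⟨hdiff, ?_⟩
  rintro A rfl
  -- The combinations are fixed by the initial data `e₀`, `e₂`, `e₁`. With `ye(0) = 1 / κ`, column 0
  -- is `κ ye`. Column 2 is `-ya + r ye`, which vanishes at `0` and has `m = 1`. Column 1 is `-u' /
  -- κ + μ y`, where `y` must have `γ = 1 / κ` to absorb the forcing `μ u'`; its other two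
  -- coefficients make `y(0)` and `m(0)` vanish.
  have v0 := he.linear_comb hL cu he κ 0
  have v2 := ha.linear_comb hL cu he (-1) r
  have v1 := (hc.linear_comb hL cu ha 1 (-r)).linear_comb hL cu he κ⁻¹ (r ^ 2 / (2 * κ))
  have t0 := hu.tendsto_column (n := 0) (b := 0) v0 (fun μ => by simp) (hsol 0) (fun μ => by
    rw [hinit']
    ext i
    fin_cases i <;> simp [hκ']
    exact Matrix.one_apply_eq _)
  have t2 := hu.tendsto_column (n := 0) (b := 0) v2 (fun μ => by simp) (hsol 2) (fun μ => by
    rw [hinit']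
    ext i
    fin_cases i <;> simp
    · field_simp
      ring
    · exact Matrix.one_apply_eq _)
  have t1 := hu.tendsto_column (n := 1) (b := -κ⁻¹) v1 (fun μ => by push_cast; ring) (hsol 1)
    (fun μ => by
      rw [hinit']
      ext i
      fin_cases i <;> simp [hκ']
      · right
        field_simp
        ring
      · exact Matrix.one_apply_eq _)
  simp only [hinit] at t0 t1 t2
  -- the rescaled matrix
  set B : ℂ → Matrix (Fin 3) (Fin 3) ℂ := fun μ => Matrix.of fun i j =>
    (columnMatrix (z μ) L - 1) i j / (![μ, 1, μ] i * ![1, μ, 1] j) with hB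
  set A : Matrix (Fin 3) (Fin 3) ℝ := !![Je - r * Ie,
    ((Jc - r * Ja + r ^ 2 / 2 * Je) - r * (Ic - r * Ia + r ^ 2 / 2 * Ie)) /
              κ ^ 2, ((-Ja + r * Je) - r * (-Ia + r * Ie)) / κ;
            κ ^ 2 * Te, Tc - r * Ta + r ^ 2 / 2 * Te, κ * (-Ta + r * Te);
            κ * Ie, (Ic - r * Ia + r ^ 2 / 2 * Ie) / κ, -Ia + r * Ie] with hA
  have hBA : Tendsto B (𝓝[≠] 0) (𝓝 (A.map Complex.ofReal)) := by
    refine tendsto_pi_nhds.2 fun i => tendsto_pi_nhds.2 fun j => ?_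
    fin_cases i <;> fin_cases j
    · refine (t0.1.congr fun μ => ?_).trans (le_of_eq (congrArg 𝓝 (congrArg Complex.ofReal ?_)))
      · simp [hB, columnMatrix]
      · simp [hA]
        field_simp
    · refine (t1.1.congr fun μ => ?_).trans (le_of_eq (congrArg 𝓝 (congrArg Complex.ofReal ?_)))
      · simp [hB, columnMatrix, div_div]
      · simp [hA]
        field_simp
        ring
    · refine (t2.1.congr fun μ => ?_).trans (le_of_eq (congrArg 𝓝 (congrArg Complex.ofReal ?_)))
      · simp [hB, columnMatrix]
      · simp [hA]
    · refine (t0.2.1.congr fun μ => ?_).trans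
        (le_of_eq (congrArg 𝓝 (congrArg Complex.ofReal ?_)))
      · simp [hB, columnMatrix]
      · simp [hA]
        ring
    · refine (t1.2.1.congr fun μ => ?_).trans
        (le_of_eq (congrArg 𝓝 (congrArg Complex.ofReal ?_)))
      · simp [hB, columnMatrix]
      · simp [hA]
        field_simp
        ring
    · refine (t2.2.1.congr fun μ => ?_).trans
        (le_of_eq (congrArg 𝓝 (congrArg Complex.ofReal ?_)))
      · simp [hB, columnMatrix]
      · simp [hA]
        ring
    · refine (t0.2.2.congr fun μ => ?_).trans
        (le_of_eq (congrArg 𝓝 (congrArg Complex.ofReal ?_)))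
      · simp [hB, columnMatrix]
      · simp [hA]
    · refine (t1.2.2.congr fun μ => ?_).trans
        (le_of_eq (congrArg 𝓝 (congrArg Complex.ofReal ?_)))
      · simp [hB, columnMatrix, div_div]
      · simp [hA]
        field_simp
        ring
    · refine (t2.2.2.congr fun μ => ?_).trans
        (le_of_eq (congrArg 𝓝 (congrArg Complex.ofReal ?_)))
      · simp [hB, columnMatrix]
      · simp [hA]
  have hent : ∀ μ ≠ 0, ∀ i j, (columnMatrix (z μ) L - 1) i j =
      (![μ, 1, μ] i * ![1, μ, 1] j) * B μ i j := by
    intro μ hμ i j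
    have : (![μ, 1, μ] i * ![1, μ, 1] j) ≠ 0 := by
      fin_cases i <;> fin_cases j <;> simp [hμ]
    simp only [hB, Matrix.of_apply]
    rw [mul_comm, div_mul_cancel₀ _ this]
  -- The row and column weights multiply to `μ³` in the determinant and to `μ²` in every principal
  -- `2 × 2` minor.
  have hdetB : ∀ μ ≠ 0, (columnMatrix (z μ) L - 1).det = μ ^ 3 * (B μ).det := by
    intro μ hμ
    rw [Matrix.det_fin_three, Matrix.det_fin_three]
    simp only [hent μ hμ]
    simp
    ring
  have htrB : ∀ μ ≠ 0, (columnMatrix (z μ) L - 1).adjugate.trace =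
      μ ^ 2 * (B μ).adjugate.trace := by
    intro μ hμ
    simp only [Matrix.adjugate_fin_three, Matrix.trace_fin_three, hent μ hμ]
    simp
    ring
  have hadj : ∀ μ ≠ 0, (columnMatrix (z μ) L).adjugate.trace = (columnMatrix (z (-μ)) L).trace := by
    intro μ hμ
    have hw := hz (-μ)
    exact ((hw.trace_eq hL (neg_ne_zero.2 hμ) (by rw [neg_neg]; exact hz μ))).symm
  have han : AnalyticAt ℂ (fun μ => (columnMatrix (z μ) L).trace) 0 := by
    simp only [Matrix.trace_fin_three]
    exact (((hdiff 0 0).add (hdiff 1 1)).add (hdiff 2 2)).analyticAt 0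
  have hAdet : (A.map Complex.ofReal).det = ((A.det : ℝ) : ℂ) := by
    simp [Matrix.det_fin_three]
  have hAadj : (A.map Complex.ofReal).adjugate.trace = ((A.adjugate.trace : ℝ) : ℂ) := by
    simp [Matrix.adjugate_fin_three, Matrix.trace_fin_three]
  have hcd : Continuous fun X : Matrix (Fin 3) (Fin 3) ℂ => X.det := continuous_id.matrix_det
  have hct : Continuous fun X : Matrix (Fin 3) (Fin 3) ℂ => X.adjugate.trace :=
    continuous_id.matrix_adjugate.matrix_trace
  have key := han.iteratedDeriv_two_three_of_tendsto (c := 3) (d := ((A.det : ℝ) : ℂ))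
    (e := ((A.adjugate.trace : ℝ) : ℂ)) ?_ ?_
  · push_cast
    exact key
  · rw [← hAdet]
    refine ((hcd.tendsto _).comp hBA).congr' ?_
    filter_upwards [self_mem_nhdsWithin] with μ hμ
    have hμ' : μ ≠ 0 := hμ
    rw [← hadj μ hμ', ← Matrix.det_sub_one_fin_three ((hz μ).det_eq_one hL), hdetB μ hμ']
    simp only [Function.comp_apply]
    field_simp
  · rw [← hAadj]
    refine ((hct.tendsto _).comp hBA).congr' ?_
    filter_upwards [self_mem_nhdsWithin] with μ hμ
    have hμ' : μ ≠ 0 := hμ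
    rw [← hadj μ hμ', ← Matrix.trace_adjugate_sub_one_fin_three, htrB μ hμ']
    simp only [Function.comp_apply]
    field_simp

end IsOscillation

/-! ### Differentiation under the integral sign -/

section ParametricIntegral

variable {H : Type*} [NormedAddCommGroup H] [NormedSpace ℝ H]

theorem ContDiffOn.continuousOn_fderiv_left {Ω : Set H} (hΩ : IsOpen Ω) {K : H → ℝ → ℝ}
    (hK : ContDiffOn ℝ 1 (Function.uncurry K) (Ω ×ˢ univ)) :
    (∀ q ∈ Ω, ∀ t, HasFDerivAt (fun q => K q t) (fderiv ℝ (fun q => K q t) q) q) ∧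
    ContinuousOn (fun p : H × ℝ => fderiv ℝ (fun q => K q p.2) p.1) (Ω ×ˢ univ) := by
  have hopen : IsOpen (Ω ×ˢ (univ : Set ℝ)) := hΩ.prod isOpen_univ
  have hd : ∀ p ∈ Ω ×ˢ (univ : Set ℝ), HasFDerivAt (fun q => K q p.2)
      ((fderiv ℝ (Function.uncurry K) p).comp (ContinuousLinearMap.inl ℝ H ℝ)) p.1 := by
    rintro ⟨q, t⟩ hp
    have h1 := ((hK.contDiffAt (hopen.mem_nhds hp)).differentiableAt one_ne_zero).hasFDerivAt
    exact HasFDerivAt.comp (f := fun q : H => (q, t)) q h1 (hasFDerivAt_prodMk_left q t)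
  refine ⟨fun q hq t => (hd (q, t) ⟨hq, mem_univ t⟩).differentiableAt.hasFDerivAt, ?_⟩
  have hc : ContinuousOn (fun p : H × ℝ =>
      (fderiv ℝ (Function.uncurry K) p).comp (ContinuousLinearMap.inl ℝ H ℝ)) (Ω ×ˢ univ) :=
    (hK.continuousOn_fderiv_of_isOpen hopen le_rfl).clm_comp continuousOn_const
  exact hc.congr fun p hp => (hd p hp).fderiv

/-- Differentiation under the integral sign for a jointly `C¹` integrand. -/
theorem ContDiffOn.hasFDerivAt_intervalIntegral {Ω : Set H} (hΩ : IsOpen Ω) {K : H → ℝ → ℝ}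
    (hK : ContDiffOn ℝ 1 (Function.uncurry K) (Ω ×ˢ univ)) {q : H} (hq : q ∈ Ω) (a b : ℝ) :
    HasFDerivAt (fun q => ∫ t in a..b, K q t)
      (∫ t in a..b, fderiv ℝ (fun q => K q t) q) q := by
  obtain ⟨hd, hc⟩ := hK.continuousOn_fderiv_left hΩ
  have hopen : IsOpen (Ω ×ˢ (univ : Set ℝ)) := hΩ.prod isOpen_univ
  have hcK : ∀ q ∈ Ω, Continuous (K q) := fun q hq =>
    hK.continuousOn.comp_continuous (f := fun t : ℝ => (q, t)) (by fun_prop)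
      (fun t => ⟨hq, mem_univ t⟩)
  have hcK' : Continuous fun t => fderiv ℝ (fun q => K q t) q :=
    hc.comp_continuous (f := fun t : ℝ => (q, t)) (by fun_prop) (fun t => ⟨hq, mem_univ t⟩)
  obtain ⟨B, hB⟩ := (isCompact_uIcc (a := a) (b := b)).exists_bound_of_continuousOn
    hcK'.continuousOn
  -- A bound on the compact interval at `q` persists, uniformly in `t`, for nearby parameters; this
  -- provides the constant dominating function.
  have hev : ∀ᶠ q' in 𝓝 q, ∀ t ∈ uIcc a b, ‖fderiv ℝ (fun q => K q t) q'‖ ≤ B + 1 := by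
    refine isCompact_uIcc.eventually_forall_of_forall_eventually
      (P := fun q' t => ‖fderiv ℝ (fun q => K q t) q'‖ ≤ B + 1) fun t ht => ?_
    have h1 : ContinuousAt (fun p : H × ℝ => ‖fderiv ℝ (fun q => K q p.2) p.1‖) (q, t) :=
      (hc.continuousAt (hopen.mem_nhds ⟨hq, mem_univ t⟩)).norm
    have h2 : ‖fderiv ℝ (fun q => K q t) q‖ < B + 1 := by linarith [hB t ht]
    exact (h1.eventually (gt_mem_nhds h2)).mono fun p hp => le_of_lt hp
  refine intervalIntegral.hasFDerivAt_integral_of_dominated_of_fderiv_le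
    (s := {q' | q' ∈ Ω ∧ ∀ t ∈ uIcc a b, ‖fderiv ℝ (fun q => K q t) q'‖ ≤ B + 1})
    (bound := fun _ => B + 1)
    (F' := fun q t => fderiv ℝ (fun q => K q t) q) ((hΩ.eventually_mem hq).and hev) ?_
    ((hcK q hq).intervalIntegrable a b) hcK'.aestronglyMeasurable ?_
    intervalIntegrable_const ?_
  · filter_upwards [hΩ.mem_nhds hq] with q' hq'
    exact (hcK q' hq').aestronglyMeasurable
  · exact Eventually.of_forall fun t ht q' hq' => hq'.2 t (uIoc_subset_uIcc ht)
  · exact Eventually.of_forall fun t _ q' hq' => hd q' hq'.1 t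

theorem ContDiff.intervalIntegral_param {K : H → ℝ → ℝ}
    (hK : ContDiff ℝ 1 (Function.uncurry K)) (a b : ℝ) :
    ContDiff ℝ 1 fun q => ∫ t in a..b, K q t := by
  have hK' : ContDiffOn ℝ 1 (Function.uncurry K) (univ ×ˢ univ) := hK.contDiffOn
  have hc := (hK'.continuousOn_fderiv_left isOpen_univ).2
  rw [univ_prod_univ, continuousOn_univ] at hc
  rw [contDiff_one_iff_hasFDerivAt]
  exact ⟨_, intervalIntegral.continuous_parametric_intervalIntegral_of_continuous hc
    continuous_const, fun q => hK'.hasFDerivAt_intervalIntegral isOpen_univ (mem_univ q) a b⟩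

end ParametricIntegral

/-! ### Divided differences and the factorization of `E - V` -/

namespace GKdV

/-- The first divided difference of `f` at `x` and `x + d`. -/
noncomputable def divDiff (f : ℝ → ℝ) (p : ℝ × ℝ) : ℝ := ∫ σ in (0 : ℝ)..1, deriv f (p.1 + σ * p.2)

/-- The second divided difference of a primitive of `f` at `w - e`, `w`, `w - e + d`. -/
noncomputable def divDiffTwo (f : ℝ → ℝ) (p : ℝ × ℝ × ℝ) : ℝ :=
  ∫ τ in (0 : ℝ)..1, τ * divDiff f (p.1 - τ * p.2.1, τ * p.2.2)

/-- With `q = (r, s, c)`, the factor `g` in `E - V(w) = (w - r) (s - w) g` at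
`w = r + κ (s - r)`. -/
noncomputable def gap (f : ℝ → ℝ) (κ : ℝ) (q : ℝ × ℝ × ℝ) : ℝ :=
  divDiffTwo f (q.1 + κ * (q.2.1 - q.1), κ * (q.2.1 - q.1), q.2.1 - q.1) - q.2.2 / 2

variable {f F : ℝ → ℝ}

theorem contDiff_deriv (hf : ContDiff ℝ 2 f) : ContDiff ℝ 1 (deriv f) :=
  (contDiff_succ_iff_deriv.1 (show ContDiff ℝ (1 + 1) f from by simpa [one_add_one_eq_two] using hf)).2.2

theorem hasDerivAt_of_contDiff (hf : ContDiff ℝ 2 f) (x : ℝ) : HasDerivAt f (deriv f x) x :=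
  ((hf.differentiable two_ne_zero) x).hasDerivAt

theorem hasDerivAt_potential (hF : ∀ v, HasDerivAt F (f v) v) (a c v : ℝ) :
    HasDerivAt (potential F a c) (f v - c * v - a) v := by
  have h1 : HasDerivAt (fun v : ℝ => c / 2 * v ^ 2) (c / 2 * (2 * v)) v := by
    simpa using (hasDerivAt_pow 2 v).const_mul (c / 2)
  have h2 : HasDerivAt (fun v : ℝ => a * v) a v := by
    simpa using (hasDerivAt_id v).const_mul a
  exact (((hF v).sub h1).sub h2).congr_deriv (by ring)

theorem contDiff_divDiff (hf : ContDiff ℝ 2 f) : ContDiff ℝ 1 (divDiff f) := by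
  refine ContDiff.intervalIntegral_param (K := fun (p : ℝ × ℝ) σ => deriv f (p.1 + σ * p.2)) ?_ 0 1
  have := contDiff_deriv hf
  unfold Function.uncurry
  fun_prop

theorem contDiff_divDiffTwo (hf : ContDiff ℝ 2 f) : ContDiff ℝ 1 (divDiffTwo f) := by
  refine ContDiff.intervalIntegral_param
    (K := fun (p : ℝ × ℝ × ℝ) τ => τ * divDiff f (p.1 - τ * p.2.1, τ * p.2.2)) ?_ 0 1
  have := contDiff_divDiff hf
  unfold Function.uncurry
  fun_prop

/-- Divided differences written as averages of `f'` are as smooth as `f'`, also where nodes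
coincide, that is, at the turning points. -/
theorem contDiff_gap (hf : ContDiff ℝ 2 f) :
    ContDiff ℝ 1 fun p : ℝ × (ℝ × ℝ × ℝ) => gap f p.1 p.2 := by
  have := contDiff_divDiffTwo hf
  unfold gap
  fun_prop

theorem mul_divDiff (hf : ContDiff ℝ 2 f) (x d : ℝ) : d * divDiff f (x, d) = f (x + d) - f x := by
  have hc := (contDiff_deriv hf).continuous
  unfold divDiff
  rw [← intervalIntegral.integral_const_mul,
    intervalIntegral.integral_eq_sub_of_hasDerivAt (f := fun σ => f (x + σ * d)) (fun σ _ => ?_)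
      (Continuous.intervalIntegrable (by fun_prop) _ _)]
  · simp
  · have h1 : HasDerivAt (fun σ => x + σ * d) d σ := by
      simpa using ((hasDerivAt_id σ).mul_const d).const_add x
    exact ((hasDerivAt_of_contDiff hf _).comp σ h1).congr_deriv (by ring)

theorem mul_integral_line (hf : ContDiff ℝ 2 f) (hF : ∀ v, HasDerivAt F (f v) v) (w d : ℝ) :
    d * ∫ τ in (0 : ℝ)..1, f (w + τ * d) = F (w + d) - F w := by
  have hc := hf.continuous
  rw [← intervalIntegral.integral_const_mul,
    intervalIntegral.integral_eq_sub_of_hasDerivAt (f := fun σ => F (w + σ * d)) (fun σ _ => ?_)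
      (Continuous.intervalIntegrable (by fun_prop) _ _)]
  · simp
  · have h1 : HasDerivAt (fun σ => w + σ * d) d σ := by
      simpa using ((hasDerivAt_id σ).mul_const d).const_add w
    exact ((hF _).comp σ h1).congr_deriv (by ring)

/-- Multiplying by the node differences avoids division, so the identity covers coincident nodes. It
follows by integrating the first-difference identity for `f` along the segments from `w` to the two
outer nodes. -/
theorem mul_divDiffTwo (hf : ContDiff ℝ 2 f) (hF : ∀ v, HasDerivAt F (f v) v) (w e d : ℝ) :
    e * (d - e) * d * divDiffTwo f (w, e, d) =
      e * (F (w + (d - e)) - F w) + (d - e) * (F (w - e) - F w) := by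
  have hc := hf.continuous
  have h1 : d * divDiffTwo f (w, e, d) =
      (∫ τ in (0 : ℝ)..1, f (w + τ * (d - e))) - ∫ τ in (0 : ℝ)..1, f (w + τ * (-e)) := by
    unfold divDiffTwo
    rw [← intervalIntegral.integral_const_mul, ← intervalIntegral.integral_sub
      (Continuous.intervalIntegrable (by fun_prop) _ _)
      (Continuous.intervalIntegrable (by fun_prop) _ _)]
    refine intervalIntegral.integral_congr fun τ _ => ?_
    have h2 := mul_divDiff hf (w - τ * e) (τ * d)
    have e1 : w - τ * e + τ * d = w + τ * (d - e) := by ring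
    have e2 : w - τ * e = w + τ * (-e) := by ring
    rw [e1] at h2
    rw [← e2, ← h2]
    ring
  have h2 := mul_integral_line hf hF w (d - e)
  have h3 := mul_integral_line hf hF w (-e)
  rw [← sub_eq_add_neg] at h3
  rw [← h2, ← h3]
  linear_combination e * (d - e) * h1

/-- Factorization of `E - V` at its two roots. -/
theorem sub_potential (hf : ContDiff ℝ 2 f) (hF : ∀ v, HasDerivAt F (f v) v) {a E c r s : ℝ}
    (hrs : r < s) (hr : potential F a c r = E) (hs : potential F a c s = E) (κ : ℝ) :
    E - potential F a c (r + κ * (s - r)) = (s - r) ^ 2 * (κ * (1 - κ)) * gap f κ (r, s, c) := by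
  have hd : s - r ≠ 0 := (sub_pos.2 hrs).ne'
  have key := mul_divDiffTwo hf hF (r + κ * (s - r)) (κ * (s - r)) (s - r)
  have e1 : r + κ * (s - r) + (s - r - κ * (s - r)) = s := by ring
  have e2 : r + κ * (s - r) - κ * (s - r) = r := by ring
  rw [e1, e2] at key
  unfold potential at hr hs ⊢
  unfold gap
  apply mul_left_cancel₀ hd
  simp only
  linear_combination (-(s - r)) * ((1 - κ) * hr + κ * hs) - key

/-- The admissible turning points: those of an actual oscillation. -/
def admissible (f : ℝ → ℝ) : Set (ℝ × ℝ × ℝ) :=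
  {q | q.1 < q.2.1 ∧ ∀ κ ∈ Icc (0 : ℝ) 1, 0 < gap f κ q}

theorem mem_admissible_iff {q : ℝ × ℝ × ℝ} :
    q ∈ admissible f ↔ q.1 < q.2.1 ∧ ∀ κ ∈ Icc (0 : ℝ) 1, 0 < gap f κ q := Iff.rfl

/-- Positivity on the compact range of `κ` is an open condition, by joint continuity of `gap`. -/
theorem isOpen_admissible (hf : ContDiff ℝ 2 f) : IsOpen (admissible f) := by
  have hlt : IsOpen {q : ℝ × ℝ × ℝ | q.1 < q.2.1} := isOpen_lt (by fun_prop) (by fun_prop)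
  refine hlt.inter (t := {q | ∀ κ ∈ Icc (0 : ℝ) 1, 0 < gap f κ q})
    (isOpen_iff_eventually.2 fun q h2 => ?_)
  refine isCompact_Icc.eventually_forall_of_forall_eventually
    (P := fun q κ => 0 < gap f κ q) fun κ hκ => ?_
  have hc : Continuous fun p : (ℝ × ℝ × ℝ) × ℝ => gap f p.2 p.1 :=
    (contDiff_gap hf).continuous.comp (g := fun p : ℝ × (ℝ × ℝ × ℝ) => gap f p.1 p.2)
      (f := fun p : (ℝ × ℝ × ℝ) × ℝ => (p.2, p.1)) (by fun_prop)
  exact hc.continuousAt.eventually (lt_mem_nhds (h2 κ hκ))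

/-- The simple roots enclosing a well are admissible turning points. -/
theorem mem_admissible (hf : ContDiff ℝ 2 f) (hF : ∀ v, HasDerivAt F (f v) v) {a E c r s : ℝ}
    (hrs : r < s) (hr : potential F a c r = E) (hs : potential F a c s = E)
    (hbelow : ∀ v ∈ Ioo r s, potential F a c v < E)
    (hr' : deriv (potential F a c) r ≠ 0) (hs' : deriv (potential F a c) s ≠ 0) :
    (r, s, c) ∈ admissible f := by
  have hd : 0 < s - r := sub_pos.2 hrs
  have hcd : ContDiff ℝ 1 fun κ => gap f κ (r, s, c) :=
    (contDiff_gap hf).comp (g := fun p : ℝ × (ℝ × ℝ × ℝ) => gap f p.1 p.2)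
      (f := fun κ : ℝ => (κ, (r, s, c))) (by fun_prop)
  have hcont := hcd.continuous
  have hdiff : ∀ κ, DifferentiableAt ℝ (fun κ => gap f κ (r, s, c)) κ :=
    hcd.differentiable one_ne_zero
  have hVd := hasDerivAt_potential hF a c
  have hpos : ∀ κ ∈ Ioo (0 : ℝ) 1, 0 < gap f κ (r, s, c) := by
    intro κ hκ
    have h1 := sub_potential hf hF hrs hr hs κ
    have h2 : r + κ * (s - r) ∈ Ioo r s := by
      constructor
      · nlinarith [hκ.1]
      · nlinarith [hκ.2]
    have h3 := hbelow _ h2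
    have h4 : 0 < (s - r) ^ 2 * (κ * (1 - κ)) := by
      have := hκ.1
      have : 0 < 1 - κ := by linarith [hκ.2]
      positivity
    by_contra hneg
    push Not at hneg
    nlinarith [mul_nonneg h4.le (neg_nonneg.2 hneg)]
  have hnonneg : ∀ κ ∈ Icc (0 : ℝ) 1, 0 ≤ gap f κ (r, s, c) := by
    intro κ hκ
    have hcl : IsClosed {κ | 0 ≤ gap f κ (r, s, c)} := isClosed_le continuous_const hcont
    have hsub : closure (Ioo (0 : ℝ) 1) ⊆ {κ | 0 ≤ gap f κ (r, s, c)} :=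
      closure_minimal (fun κ hκ => (hpos κ hκ).le) hcl
    rw [closure_Ioo zero_ne_one] at hsub
    exact hsub hκ
  -- the derivative of `E - V` along the segment
  have hder : ∀ κ, -(f (r + κ * (s - r)) - c * (r + κ * (s - r)) - a) * (s - r) =
      (s - r) ^ 2 * ((1 - 2 * κ) * gap f κ (r, s, c) +
        κ * (1 - κ) * deriv (fun κ => gap f κ (r, s, c)) κ) := by
    intro κ
    have h1 : HasDerivAt (fun κ => r + κ * (s - r)) (s - r) κ := by
      simpa using ((hasDerivAt_id κ).mul_const (s - r)).const_add r
    have h2 := ((hVd (r + κ * (s - r))).comp κ h1).const_sub E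
    have h3 : HasDerivAt (fun κ : ℝ => κ * (1 - κ)) (1 - 2 * κ) κ :=
      ((hasDerivAt_id κ).mul ((hasDerivAt_id κ).const_sub 1)).congr_deriv (by simp; ring)
    have h4 := ((h3.const_mul ((s - r) ^ 2)).mul (hdiff κ).hasDerivAt)
    have h5 := h2.congr_of_eventuallyEq (f₁ := fun κ => (s - r) ^ 2 * (κ * (1 - κ)) *
      gap f κ (r, s, c)) (Eventually.of_forall fun κ => (sub_potential hf hF hrs hr hs κ).symm)
    have h6 := h5.unique h4
    linear_combination h6
  rw [mem_admissible_iff]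
  refine And.intro hrs fun κ hκ => ?_
  -- At an endpoint `κ (1 - κ) = 0`, so by `hder` a vanishing `gap` would make `V'` vanish at the
  -- root, against simplicity.
  rcases eq_or_lt_of_le hκ.1 with h0 | h0
  · refine (hnonneg κ hκ).lt_of_ne fun h => hr' ?_
    subst h0
    have := hder 0
    rw [← h] at this
    simp [hd.ne'] at this
    have h2 : f r - c * r - a = 0 := by linarith
    rw [(hVd r).deriv, h2]
  rcases eq_or_lt_of_le hκ.2 with h1 | h1
  · refine (hnonneg κ hκ).lt_of_ne fun h => hs' ?_
    subst h1
    have := hder 1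
    rw [← h] at this
    simp [hd.ne'] at this
    have h2 : f s - c * s - a = 0 := by linarith
    rw [(hVd s).deriv, h2]
  · exact hpos κ ⟨h0, h1⟩

attribute [irreducible] gap

/-! ### The wave in the phase variable -/

/-- The height of the wave at phase `θ`, for turning points `q = (r, s, c)`. -/
noncomputable def height (q : ℝ × ℝ × ℝ) (θ : ℝ) : ℝ := q.1 + Real.sin θ ^ 2 * (q.2.1 - q.1)

/-- The derivative `dx/dθ` of the position with respect to the phase. -/
noncomputable def density (f : ℝ → ℝ) (q : ℝ × ℝ × ℝ) (θ : ℝ) : ℝ :=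
  (√(gap f (Real.sin θ ^ 2) q / 2))⁻¹

/-- The slope `u_x` of the wave as a function of the phase. -/
noncomputable def speed (f : ℝ → ℝ) (q : ℝ × ℝ × ℝ) (θ : ℝ) : ℝ :=
  (q.2.1 - q.1) * Real.sin (2 * θ) * √(gap f (Real.sin θ ^ 2) q / 2)

/-- The parameter `a` for which `q = (r, s, c)` are turning points. -/
noncomputable def level (F : ℝ → ℝ) (q : ℝ × ℝ × ℝ) : ℝ :=
  (F q.2.1 - F q.1) / (q.2.1 - q.1) - q.2.2 / 2 * (q.2.1 + q.1)

/-- The acceleration `u_xx` of the wave as a function of the phase. -/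
noncomputable def force (f F : ℝ → ℝ) (q : ℝ × ℝ × ℝ) (θ : ℝ) : ℝ :=
  level F q + q.2.2 * height q θ - f (height q θ)

theorem contDiff_one_of_hasDerivAt (hf : ContDiff ℝ 2 f) (hF : ∀ v, HasDerivAt F (f v) v) :
    ContDiff ℝ 1 F := by
  rw [contDiff_one_iff_deriv]
  refine ⟨fun v => (hF v).differentiableAt, ?_⟩
  rw [show deriv F = f from funext fun v => (hF v).deriv]
  exact hf.continuous

theorem sin_sq_mem (θ : ℝ) : Real.sin θ ^ 2 ∈ Icc (0 : ℝ) 1 :=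
  ⟨sq_nonneg _, Real.sin_sq_le_one θ⟩

theorem gap_pos {q : ℝ × ℝ × ℝ} (hq : q ∈ admissible f) (θ : ℝ) :
    0 < gap f (Real.sin θ ^ 2) q := (mem_admissible_iff.1 hq).2 _ (sin_sq_mem θ)

theorem density_pos {q : ℝ × ℝ × ℝ} (hq : q ∈ admissible f) (θ : ℝ) : 0 < density f q θ := by
  have := gap_pos hq θ
  unfold density
  positivity

theorem speed_mul_density {q : ℝ × ℝ × ℝ} (hq : q ∈ admissible f) (θ : ℝ) :
    speed f q θ * density f q θ = (q.2.1 - q.1) * Real.sin (2 * θ) := by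
  have h := gap_pos hq θ
  have : √(gap f (Real.sin θ ^ 2) q / 2) ≠ 0 := by positivity
  unfold speed density
  field_simp

theorem contDiff_height : ContDiff ℝ 1 (Function.uncurry height) := by
  unfold height Function.uncurry
  fun_prop

theorem contDiff_gap_sin (hf : ContDiff ℝ 2 f) :
    ContDiff ℝ 1 fun p : (ℝ × ℝ × ℝ) × ℝ => gap f (Real.sin p.2 ^ 2) p.1 :=
  (contDiff_gap hf).comp (g := fun p : ℝ × (ℝ × ℝ × ℝ) => gap f p.1 p.2)
    (f := fun p : (ℝ × ℝ × ℝ) × ℝ => (Real.sin p.2 ^ 2, p.1)) (by fun_prop)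

theorem contDiffOn_sqrt_gap (hf : ContDiff ℝ 2 f) :
    ContDiffOn ℝ 1 (fun p : (ℝ × ℝ × ℝ) × ℝ => √(gap f (Real.sin p.2 ^ 2) p.1 / 2))
      (admissible f ×ˢ univ) :=
  ((contDiff_gap_sin hf).contDiffOn.div_const 2).sqrt fun p hp => by
    have := gap_pos hp.1 p.2
    positivity

theorem contDiffOn_density (hf : ContDiff ℝ 2 f) :
    ContDiffOn ℝ 1 (Function.uncurry (density f)) (admissible f ×ˢ univ) :=
  (contDiffOn_sqrt_gap hf).inv fun p hp => by
    have := gap_pos hp.1 p.2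
    positivity

theorem contDiffOn_speed (hf : ContDiff ℝ 2 f) :
    ContDiffOn ℝ 1 (Function.uncurry (speed f)) (admissible f ×ˢ univ) := by
  have h : ContDiff ℝ 1 fun p : (ℝ × ℝ × ℝ) × ℝ => (p.1.2.1 - p.1.1) * Real.sin (2 * p.2) := by
    fun_prop
  exact h.contDiffOn.mul (contDiffOn_sqrt_gap hf)

theorem contDiffOn_level (hf : ContDiff ℝ 2 f) (hF : ∀ v, HasDerivAt F (f v) v) :
    ContDiffOn ℝ 1 (level F) (admissible f) := by
  have hF1 := contDiff_one_of_hasDerivAt hf hF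
  have h1 : ContDiff ℝ 1 fun q : ℝ × ℝ × ℝ => F q.2.1 - F q.1 := by fun_prop
  have h2 : ContDiff ℝ 1 fun q : ℝ × ℝ × ℝ => q.2.1 - q.1 := by fun_prop
  have h3 : ContDiff ℝ 1 fun q : ℝ × ℝ × ℝ => q.2.2 / 2 * (q.2.1 + q.1) := by fun_prop
  exact (h1.contDiffOn.div h2.contDiffOn fun q hq =>
    (sub_pos.2 (mem_admissible_iff.1 hq).1).ne').sub h3.contDiffOn

theorem contDiffOn_force (hf : ContDiff ℝ 2 f) (hF : ∀ v, HasDerivAt F (f v) v) :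
    ContDiffOn ℝ 1 (Function.uncurry (force f F)) (admissible f ×ˢ univ) := by
  have h1 : ContDiffOn ℝ 1 (fun p : (ℝ × ℝ × ℝ) × ℝ => level F p.1) (admissible f ×ˢ univ) :=
    (contDiffOn_level hf hF).comp contDiff_fst.contDiffOn fun p hp => hp.1
  have hf1 : ContDiff ℝ 1 f := hf.of_le one_le_two
  have h2 : ContDiff ℝ 1 fun p : (ℝ × ℝ × ℝ) × ℝ => p.1.2.2 * height p.1 p.2 := by
    unfold height
    fun_prop
  have h3 : ContDiff ℝ 1 fun p : (ℝ × ℝ × ℝ) × ℝ => f (height p.1 p.2) := by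
    unfold height
    fun_prop
  exact (h1.add h2.contDiffOn).sub h3.contDiffOn

theorem continuous_of_contDiffOn {Ω : Set (ℝ × ℝ × ℝ)} {K : ℝ × ℝ × ℝ → ℝ → ℝ}
    (hK : ContDiffOn ℝ 1 (Function.uncurry K) (Ω ×ˢ univ)) {q : ℝ × ℝ × ℝ} (hq : q ∈ Ω) :
    Continuous (K q) :=
  hK.continuousOn.comp_continuous (f := fun t : ℝ => (q, t)) (by fun_prop)
    (fun t => ⟨hq, mem_univ t⟩)

theorem hasDerivAt_height (q : ℝ × ℝ × ℝ) (θ : ℝ) :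
    HasDerivAt (height q) ((q.2.1 - q.1) * Real.sin (2 * θ)) θ := by
  have h := ((((Real.hasDerivAt_sin θ).pow 2).mul_const (q.2.1 - q.1)).const_add q.1)
  refine h.congr_deriv ?_
  rw [Real.sin_two_mul]
  simp
  ring

theorem level_eq {a E : ℝ} {q : ℝ × ℝ × ℝ} (hq : q.1 < q.2.1)
    (hr : potential F a q.2.2 q.1 = E) (hs : potential F a q.2.2 q.2.1 = E) : level F q = a := by
  have hd : q.2.1 - q.1 ≠ 0 := (sub_pos.2 hq).ne'
  unfold level potential at *
  rw [sub_eq_iff_eq_add, div_eq_iff hd]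
  linear_combination hs - hr

theorem potential_level {q : ℝ × ℝ × ℝ} (hq : q.1 < q.2.1) :
    potential F (level F q) q.2.2 q.2.1 = potential F (level F q) q.2.2 q.1 := by
  have hd : q.2.1 - q.1 ≠ 0 := (sub_pos.2 hq).ne'
  unfold level potential
  field_simp
  ring

theorem sin_two_mul_sq (θ : ℝ) :
    Real.sin (2 * θ) ^ 2 = 4 * (Real.sin θ ^ 2 * (1 - Real.sin θ ^ 2)) := by
  rw [Real.sin_two_mul]
  have := Real.sin_sq_add_cos_sq θ
  linear_combination 4 * Real.sin θ ^ 2 * this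

/-- Conservation of energy along the wave. -/
theorem speed_sq (hf : ContDiff ℝ 2 f) (hF : ∀ v, HasDerivAt F (f v) v) {q : ℝ × ℝ × ℝ}
    (hq : q ∈ admissible f) (θ : ℝ) :
    speed f q θ ^ 2 = 2 * (potential F (level F q) q.2.2 q.1 -
      potential F (level F q) q.2.2 (height q θ)) := by
  have h := gap_pos hq θ
  have hlt := (mem_admissible_iff.1 hq).1
  have key := sub_potential hf hF hlt rfl (potential_level (F := F) hlt) (Real.sin θ ^ 2)
  unfold height
  rw [key]
  unfold speed
  rw [mul_pow, mul_pow, Real.sq_sqrt (by positivity), sin_two_mul_sq]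
  ring

/-- The equation of motion in the phase variable. -/
theorem hasDerivAt_speed (hf : ContDiff ℝ 2 f) (hF : ∀ v, HasDerivAt F (f v) v) {q : ℝ × ℝ × ℝ}
    (hq : q ∈ admissible f) (θ : ℝ) :
    HasDerivAt (speed f q) (force f F q θ * density f q θ) θ := by
  have hlt := (mem_admissible_iff.1 hq).1
  have hd : q.2.1 - q.1 ≠ 0 := (sub_pos.2 hlt).ne'
  have hC : ContDiff ℝ 1 (speed f q) := by
    rw [← contDiffOn_univ]
    exact (contDiffOn_speed hf).comp (f := fun t : ℝ => (q, t)) (by fun_prop)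
      (fun t _ => ⟨hq, mem_univ t⟩)
  have hdiff : ∀ t, HasDerivAt (speed f q) (deriv (speed f q) t) t := fun t =>
    (hC.differentiable one_ne_zero t).hasDerivAt
  -- The energy identity can be differentiated and divided by `2 * speed` only where `speed` is
  -- nonzero. Its zeros are countable, so continuity of both sides extends the formula across the
  -- turning points.
  have hdense : Dense {t : ℝ | Real.sin (2 * t) ≠ 0} := by
    have hcount : {t : ℝ | Real.sin (2 * t) = 0}.Countable := by
      refine (countable_range fun n : ℤ => (n : ℝ) * Real.pi / 2).mono fun t ht => ?_
      obtain ⟨n, hn⟩ := Real.sin_eq_zero_iff.1 ht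
      exact ⟨n, by simp only; linarith⟩
    exact hcount.dense_compl ℝ
  have heq : deriv (speed f q) = fun t => force f F q t * density f q t := by
    refine Continuous.ext_on hdense (hC.continuous_deriv le_rfl)
      ((continuous_of_contDiffOn (contDiffOn_force hf hF) hq).mul
        (continuous_of_contDiffOn (contDiffOn_density hf) hq)) fun t ht => ?_
    have h1 := (hdiff t).pow 2
    have h2 := ((((hasDerivAt_potential hF (level F q) q.2.2 (height q t)).comp t
      (hasDerivAt_height q t)).const_sub (potential F (level F q) q.2.2 q.1)).const_mul 2)
    have h3 := h1.unique (h2.congr_of_eventuallyEq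
      (Eventually.of_forall fun t => speed_sq hf hF hq t))
    rw [← speed_mul_density hq t] at h3
    have hs : speed f q t ≠ 0 := by
      intro h0
      have h4 := speed_mul_density hq t
      rw [h0, zero_mul] at h4
      exact (mul_ne_zero hd ht) h4.symm
    apply mul_left_cancel₀ hs
    unfold force
    simp at h3
    linear_combination h3 / 2
  rw [← congrFun heq θ]
  exact hdiff θ

theorem speed_zero (q : ℝ × ℝ × ℝ) : speed f q 0 = 0 := by simp [speed]

theorem speed_pi (q : ℝ × ℝ × ℝ) : speed f q Real.pi = 0 := by simp [speed]

theorem height_zero (q : ℝ × ℝ × ℝ) : height q 0 = q.1 := by simp [height]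

theorem height_pi (q : ℝ × ℝ × ℝ) : height q Real.pi = q.1 := by simp [height]

/-- This form is what allows differentiation in `q` and then in `θ`: `speed` is only known to be
jointly `C¹`, so its mixed derivative is obtained by differentiating the `C¹` integrand. -/
theorem speed_eq_integral (hf : ContDiff ℝ 2 f) (hF : ∀ v, HasDerivAt F (f v) v) {q : ℝ × ℝ × ℝ}
    (hq : q ∈ admissible f) (θ : ℝ) :
    speed f q θ = ∫ t in (0 : ℝ)..θ, force f F q t * density f q t := by
  rw [intervalIntegral.integral_eq_sub_of_hasDerivAt (fun t _ => hasDerivAt_speed hf hF hq t)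
    (((continuous_of_contDiffOn (contDiffOn_force hf hF) hq).mul
        (continuous_of_contDiffOn (contDiffOn_density hf) hq)).intervalIntegrable _ _),
    speed_zero, sub_zero]

/-! ### Derivatives in the turning points -/

/-- The position `x` as a function of the phase. -/
noncomputable def position (f : ℝ → ℝ) (q : ℝ × ℝ × ℝ) (θ : ℝ) : ℝ :=
  ∫ t in (0 : ℝ)..θ, density f q t

/-- The `n`-th moment of the wave over one period. -/
noncomputable def moment (n : ℕ) (f : ℝ → ℝ) (q : ℝ × ℝ × ℝ) : ℝ :=
  ∫ t in (0 : ℝ)..Real.pi, height q t ^ n * density f q t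

/-- The derivative of the density in the direction `v` of the turning points. -/
noncomputable def dDensity (f : ℝ → ℝ) (q v : ℝ × ℝ × ℝ) (θ : ℝ) : ℝ :=
  fderiv ℝ (fun q => density f q θ) q v

/-- The derivative of the position in the direction `v` of the turning points. -/
noncomputable def dPosition (f : ℝ → ℝ) (q v : ℝ × ℝ × ℝ) (θ : ℝ) : ℝ :=
  ∫ t in (0 : ℝ)..θ, dDensity f q v t

/-- The derivative of the speed in the direction `v` of the turning points. -/
noncomputable def dSpeed (f : ℝ → ℝ) (q v : ℝ × ℝ × ℝ) (θ : ℝ) : ℝ :=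
  fderiv ℝ (fun q => speed f q θ) q v

variable {q v : ℝ × ℝ × ℝ}

theorem hasFDerivAt_height (q : ℝ × ℝ × ℝ) (θ : ℝ) :
    ∃ φ : ℝ × ℝ × ℝ →L[ℝ] ℝ, HasFDerivAt (fun q => height q θ) φ q ∧ ∀ v, φ v = height v θ := by
  have h1 : HasFDerivAt (fun q : ℝ × ℝ × ℝ => q.1) (ContinuousLinearMap.fst ℝ ℝ (ℝ × ℝ)) q :=
    hasFDerivAt_fst
  have h2 : HasFDerivAt (fun q : ℝ × ℝ × ℝ => q.2.1) ((ContinuousLinearMap.fst ℝ ℝ ℝ).comp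
    (ContinuousLinearMap.snd ℝ ℝ (ℝ × ℝ))) q := hasFDerivAt_fst.comp q hasFDerivAt_snd
  exact ⟨_, h1.add ((h2.sub h1).const_mul (Real.sin θ ^ 2)), fun v => by simp [height]⟩

theorem hasFDerivAt_density (hf : ContDiff ℝ 2 f) (hq : q ∈ admissible f) (θ : ℝ) :
    HasFDerivAt (fun q => density f q θ) (fderiv ℝ (fun q => density f q θ) q) q :=
  ((contDiffOn_density hf).continuousOn_fderiv_left (isOpen_admissible hf)).1 q hq θ

theorem hasFDerivAt_speed (hf : ContDiff ℝ 2 f) (hq : q ∈ admissible f) (θ : ℝ) :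
    HasFDerivAt (fun q => speed f q θ) (fderiv ℝ (fun q => speed f q θ) q) q :=
  ((contDiffOn_speed hf).continuousOn_fderiv_left (isOpen_admissible hf)).1 q hq θ

theorem continuous_fderiv_param {Ω : Set (ℝ × ℝ × ℝ)} (hΩ : IsOpen Ω) {K : ℝ × ℝ × ℝ → ℝ → ℝ}
    (hK : ContDiffOn ℝ 1 (Function.uncurry K) (Ω ×ˢ univ)) (hq : q ∈ Ω) :
    Continuous fun t => fderiv ℝ (fun q => K q t) q :=
  (hK.continuousOn_fderiv_left hΩ).2.comp_continuous (f := fun t : ℝ => (q, t)) (by fun_prop)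
    (fun t => ⟨hq, mem_univ t⟩)

theorem continuous_density (hf : ContDiff ℝ 2 f) (hq : q ∈ admissible f) :
    Continuous (density f q) := continuous_of_contDiffOn (contDiffOn_density hf) hq

theorem continuous_speed (hf : ContDiff ℝ 2 f) (hq : q ∈ admissible f) :
    Continuous (speed f q) := continuous_of_contDiffOn (contDiffOn_speed hf) hq

theorem continuous_height (q : ℝ × ℝ × ℝ) : Continuous (height q) := by
  unfold height
  fun_prop

theorem continuous_dDensity (hf : ContDiff ℝ 2 f) (hq : q ∈ admissible f) (v : ℝ × ℝ × ℝ) :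
    Continuous (dDensity f q v) :=
  (continuous_fderiv_param (isOpen_admissible hf) (contDiffOn_density hf) hq).clm_apply
    continuous_const

theorem hasDerivAt_position (hf : ContDiff ℝ 2 f) (hq : q ∈ admissible f) (θ : ℝ) :
    HasDerivAt (position f q) (density f q θ) θ :=
  intervalIntegral.integral_hasDerivAt_right ((continuous_density hf hq).intervalIntegrable _ _)
    ((continuous_density hf hq).stronglyMeasurableAtFilter _ _) (continuous_density hf hq).continuousAt

theorem hasDerivAt_dPosition (hf : ContDiff ℝ 2 f) (hq : q ∈ admissible f) (v : ℝ × ℝ × ℝ)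
    (θ : ℝ) : HasDerivAt (dPosition f q v) (dDensity f q v θ) θ :=
  intervalIntegral.integral_hasDerivAt_right ((continuous_dDensity hf hq v).intervalIntegrable _ _)
    ((continuous_dDensity hf hq v).stronglyMeasurableAtFilter _ _)
    (continuous_dDensity hf hq v).continuousAt

/-- The kinematic relation `height' = speed * density`, differentiated in the turning points. -/
theorem hasDerivAt_dHeight (hf : ContDiff ℝ 2 f) (hq : q ∈ admissible f) (v : ℝ × ℝ × ℝ)
    (θ : ℝ) : HasDerivAt (height v)
      (dSpeed f q v θ * density f q θ + speed f q θ * dDensity f q v θ) θ := by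
  refine (hasDerivAt_height v θ).congr_deriv ?_
  have h1 : HasFDerivAt (fun q : ℝ × ℝ × ℝ => q.1) (ContinuousLinearMap.fst ℝ ℝ (ℝ × ℝ)) q :=
    hasFDerivAt_fst
  have h2 : HasFDerivAt (fun q : ℝ × ℝ × ℝ => q.2.1) ((ContinuousLinearMap.fst ℝ ℝ ℝ).comp
    (ContinuousLinearMap.snd ℝ ℝ (ℝ × ℝ))) q := hasFDerivAt_fst.comp q hasFDerivAt_snd
  have h3 := (h2.sub h1).mul_const (Real.sin (2 * θ))
  have h4 := (hasFDerivAt_speed hf hq θ).mul (hasFDerivAt_density hf hq θ)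
  have h5 := h3.congr_of_eventuallyEq
    (((isOpen_admissible hf).eventually_mem hq).mono fun q hq => speed_mul_density hq θ)
  have h6 := congrArg (fun φ : ℝ × ℝ × ℝ →L[ℝ] ℝ => φ v) (h4.unique h5)
  simp at h6
  unfold dSpeed dDensity
  linarith

/-- The equation of motion, differentiated in the turning points. -/
theorem hasDerivAt_dSpeed (hf : ContDiff ℝ 2 f) (hF : ∀ v, HasDerivAt F (f v) v)
    (hq : q ∈ admissible f) (v : ℝ × ℝ × ℝ) (θ : ℝ) :
    HasDerivAt (dSpeed f q v) ((fderiv ℝ (level F) q v + v.2.2 * height q θ +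
      (q.2.2 - deriv f (height q θ)) * height v θ) * density f q θ +
      force f F q θ * dDensity f q v θ) θ := by
  have hK : ContDiffOn ℝ 1 (Function.uncurry fun q t => force f F q t * density f q t)
      (admissible f ×ˢ univ) := (contDiffOn_force hf hF).mul (contDiffOn_density hf)
  have hopen := isOpen_admissible hf
  have hc := continuous_fderiv_param hopen hK hq
  have h1 : ∀ t, dSpeed f q v t = ∫ s in (0 : ℝ)..t,
      fderiv ℝ (fun q => force f F q s * density f q s) q v := by
    intro t
    have h2 := (hK.hasFDerivAt_intervalIntegral hopen hq 0 t).congr_of_eventuallyEq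
      (f₁ := fun q => speed f q t)
      ((hopen.eventually_mem hq).mono fun q hq => speed_eq_integral hf hF hq t)
    rw [dSpeed, h2.fderiv, ContinuousLinearMap.intervalIntegral_apply (hc.intervalIntegrable _ _)]
  have hc' : Continuous fun s => fderiv ℝ (fun q => force f F q s * density f q s) q v :=
    hc.clm_apply continuous_const
  rw [show dSpeed f q v = fun t => _ from funext h1]
  refine (intervalIntegral.integral_hasDerivAt_right (hc'.intervalIntegrable _ _)
    (hc'.stronglyMeasurableAtFilter _ _) hc'.continuousAt).congr_deriv ?_
  obtain ⟨φ, hφ, hφv⟩ := hasFDerivAt_height q θ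
  have hlev := ((contDiffOn_level hf hF).differentiableOn one_ne_zero).differentiableAt
    (hopen.mem_nhds hq) |>.hasFDerivAt
  have hthird : HasFDerivAt (fun q : ℝ × ℝ × ℝ => q.2.2) ((ContinuousLinearMap.snd ℝ ℝ ℝ).comp
    (ContinuousLinearMap.snd ℝ ℝ (ℝ × ℝ))) q := hasFDerivAt_snd.comp q hasFDerivAt_snd
  have hforce : HasFDerivAt (fun q => force f F q θ) _ q :=
    (hlev.add (hthird.mul hφ)).sub
      ((hasDerivAt_of_contDiff hf (height q θ)).comp_hasFDerivAt q hφ)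
  have hprod : HasFDerivAt (fun q => force f F q θ * density f q θ) _ q :=
    hforce.mul (hasFDerivAt_density hf hq θ)
  rw [hprod.fderiv]
  simp [hφv]
  unfold dDensity
  ring

theorem hasDerivAt_force (hf : ContDiff ℝ 2 f) (hq : q ∈ admissible f) (θ : ℝ) :
    HasDerivAt (force f F q)
      ((q.2.2 - deriv f (height q θ)) * (speed f q θ * density f q θ)) θ := by
  have h1 := hasDerivAt_height q θ
  have h2 := ((h1.const_mul q.2.2).const_add (level F q)).sub
    ((hasDerivAt_of_contDiff hf (height q θ)).comp θ h1)
  refine h2.congr_deriv ?_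
  rw [speed_mul_density hq]
  ring

/-- The derivative of the wave in the turning points at fixed position, as a function of the
phase. -/
noncomputable def variation (f : ℝ → ℝ) (q v : ℝ × ℝ × ℝ) (θ : ℝ) : ℝ :=
  height v θ - speed f q θ * dPosition f q v θ

/-- The derivative of the slope in the turning points at fixed position. -/
noncomputable def variationSlope (f F : ℝ → ℝ) (q v : ℝ × ℝ × ℝ) (θ : ℝ) : ℝ :=
  dSpeed f q v θ - force f F q θ * dPosition f q v θ

/-- Passing to fixed position subtracts the shift of phase, and the terms in `dDensity` cancel. The
factor `density` converts `d/dx` into `d/dθ`. -/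
theorem hasDerivAt_variation (hf : ContDiff ℝ 2 f) (hF : ∀ v, HasDerivAt F (f v) v)
    (hq : q ∈ admissible f) (v : ℝ × ℝ × ℝ) (θ : ℝ) :
    HasDerivAt (variation f q v) (density f q θ * variationSlope f F q v θ) θ := by
  refine ((hasDerivAt_dHeight hf hq v θ).sub
    ((hasDerivAt_speed hf hF hq θ).mul (hasDerivAt_dPosition hf hq v θ))).congr_deriv ?_
  unfold variationSlope
  ring

/-- The linearized profile equation `y'' + k y = α + γ u`, where `α` is the change of `a` and `γ`
that of `c`. -/
theorem hasDerivAt_variationSlope (hf : ContDiff ℝ 2 f) (hF : ∀ v, HasDerivAt F (f v) v)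
    (hq : q ∈ admissible f) (v : ℝ × ℝ × ℝ) (θ : ℝ) :
    HasDerivAt (variationSlope f F q v) (density f q θ * (fderiv ℝ (level F) q v +
      v.2.2 * height q θ - (deriv f (height q θ) - q.2.2) * variation f q v θ)) θ := by
  refine ((hasDerivAt_dSpeed hf hF hq v θ).sub
    ((hasDerivAt_force hf hq θ).mul (hasDerivAt_dPosition hf hq v θ))).congr_deriv ?_
  unfold variation
  ring

theorem contDiffOn_moment (n : ℕ) (hf : ContDiff ℝ 2 f) :
    ContDiffOn ℝ 1 (Function.uncurry fun q t => height q t ^ n * density f q t)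
      (admissible f ×ˢ univ) :=
  (contDiff_height.contDiffOn.pow n).mul (contDiffOn_density hf)

theorem differentiableAt_moment (n : ℕ) (hf : ContDiff ℝ 2 f) (hq : q ∈ admissible f) :
    DifferentiableAt ℝ (moment n f) q :=
  ((contDiffOn_moment n hf).hasFDerivAt_intervalIntegral (isOpen_admissible hf) hq 0
    Real.pi).differentiableAt

theorem fderiv_moment (n : ℕ) (hf : ContDiff ℝ 2 f) (hq : q ∈ admissible f) (v : ℝ × ℝ × ℝ) :
    fderiv ℝ (moment n f) q v = ∫ t in (0 : ℝ)..Real.pi,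
      (n * height q t ^ (n - 1) * height v t * density f q t +
        height q t ^ n * dDensity f q v t) := by
  have hK := contDiffOn_moment n hf
  have hopen := isOpen_admissible hf
  have h := (hK.hasFDerivAt_intervalIntegral hopen hq 0 Real.pi).fderiv
  change fderiv ℝ (moment n f) q = _ at h
  rw [h, ContinuousLinearMap.intervalIntegral_apply
    ((continuous_fderiv_param hopen hK hq).intervalIntegrable _ _)]
  refine intervalIntegral.integral_congr fun t _ => ?_
  obtain ⟨φ, hφ, hφv⟩ := hasFDerivAt_height q t
  have hprod : HasFDerivAt (fun q => height q t ^ n * density f q t) _ q :=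
    (hφ.pow n).mul (hasFDerivAt_density hf hq t)
  rw [hprod.fderiv]
  simp [hφv]
  unfold dDensity
  ring

theorem fderiv_moment_zero (hf : ContDiff ℝ 2 f) (hq : q ∈ admissible f) (v : ℝ × ℝ × ℝ) :
    fderiv ℝ (moment 0 f) q v = dPosition f q v Real.pi := by
  rw [fderiv_moment 0 hf hq v]
  simp [dPosition]

/-- The moments of the variation are the derivatives of the moments, up to the contribution of
the varying period. -/
theorem integral_variation (n : ℕ) (hf : ContDiff ℝ 2 f) (hq : q ∈ admissible f)
    (v : ℝ × ℝ × ℝ) :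
    (n + 1) * ∫ t in (0 : ℝ)..Real.pi, height q t ^ n * variation f q v t * density f q t =
      fderiv ℝ (moment (n + 1) f) q v - q.1 ^ (n + 1) * fderiv ℝ (moment 0 f) q v := by
  have c1 := continuous_height q
  have c2 := continuous_height v
  have c3 := continuous_density hf hq
  have c4 := continuous_dDensity hf hq v
  have c5 := continuous_speed hf hq
  have c6 : Continuous (dPosition f q v) :=
    continuous_iff_continuousAt.2 fun t => (hasDerivAt_dPosition hf hq v t).continuousAt
  -- The integrand is the derivative of `height ^ (n + 1) * dPosition`; this vanishes at `0`, and at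
  -- `π` the height is back at `q.1`.
  have h1 : ∫ t in (0 : ℝ)..Real.pi, ((n + 1) * height q t ^ n * (speed f q t * density f q t) *
      dPosition f q v t + height q t ^ (n + 1) * dDensity f q v t) =
      q.1 ^ (n + 1) * fderiv ℝ (moment 0 f) q v := by
    rw [fderiv_moment_zero hf hq, intervalIntegral.integral_eq_sub_of_hasDerivAt
      (f := fun t => height q t ^ (n + 1) * dPosition f q v t) (fun t _ => ?_)
      (Continuous.intervalIntegrable (by fun_prop) _ _)]
    · simp [height_pi, dPosition]
    · refine (((hasDerivAt_height q t).pow (n + 1)).mul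
        (hasDerivAt_dPosition hf hq v t)).congr_deriv ?_
      rw [speed_mul_density hq]
      simp
  rw [← h1, fderiv_moment (n + 1) hf hq, ← intervalIntegral.integral_sub
    (Continuous.intervalIntegrable (by fun_prop) _ _)
    (Continuous.intervalIntegrable (by fun_prop) _ _), ← intervalIntegral.integral_const_mul]
  refine intervalIntegral.integral_congr fun t _ => ?_
  simp [variation]
  ring

/-! ### Phase against position, and the singular integrals -/

theorem position_zero (q : ℝ × ℝ × ℝ) : position f q 0 = 0 := by simp [position]

theorem position_pi (q : ℝ × ℝ × ℝ) : position f q Real.pi = moment 0 f q := by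
  simp [position, moment]

/-- The phase as a function of the position. -/
theorem exists_phase (hf : ContDiff ℝ 2 f) (hq : q ∈ admissible f) :
    ∃ Θ : ℝ → ℝ, Θ 0 = 0 ∧ Θ (moment 0 f q) = Real.pi ∧ 0 ≤ moment 0 f q ∧
      (∀ t, Θ (position f q t) = t) ∧ ∀ x, HasDerivAt Θ (density f q (Θ x))⁻¹ x := by
  have hder := hasDerivAt_position hf hq
  have hcont : Continuous (position f q) :=
    continuous_iff_continuousAt.2 fun t => (hder t).continuousAt
  have hmono : StrictMono (position f q) := strictMono_of_deriv_pos fun t => by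
    rw [(hder t).deriv]
    exact density_pos hq t
  -- A positive lower bound on the density makes the position unbounded in both directions, hence a
  -- bijection of `ℝ`.
  obtain ⟨m, hm⟩ : ∃ m : ℝ, 0 < m ∧ ∀ t, m ≤ density f q t := by
    have hc : Continuous fun κ => gap f κ q :=
      (contDiff_gap hf).continuous.comp (g := fun p : ℝ × (ℝ × ℝ × ℝ) => gap f p.1 p.2)
        (f := fun κ : ℝ => (κ, q)) (by fun_prop)
    obtain ⟨B, hB⟩ := (isCompact_Icc (a := (0 : ℝ)) (b := 1)).exists_bound_of_continuousOn
      hc.continuousOn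
    refine ⟨(√((|B| + 1) / 2))⁻¹, by positivity, fun t => ?_⟩
    have h1 := gap_pos hq t
    have h2 : gap f (Real.sin t ^ 2) q ≤ |B| + 1 := by
      have h3 := hB _ (sin_sq_mem t)
      have h4 := le_abs_self (gap f (Real.sin t ^ 2) q)
      have h5 := le_abs_self B
      rw [Real.norm_eq_abs] at h3
      linarith
    unfold density
    gcongr
  have h0 := position_zero (f := f) q
  have hmono' : Monotone fun t => position f q t - m * t := by
    refine monotone_of_deriv_nonneg (fun t => ((hder t).sub
      ((hasDerivAt_id t).const_mul m)).differentiableAt) fun t => ?_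
    have h1 : HasDerivAt (fun t => position f q t - m * t) (density f q t - m * 1) t :=
      (hder t).sub ((hasDerivAt_id t).const_mul m)
    rw [h1.deriv]
    linarith [hm.2 t]
  have htop : Tendsto (position f q) atTop atTop := by
    refine tendsto_atTop_mono' _ ?_ (tendsto_id.const_mul_atTop hm.1)
    filter_upwards [eventually_ge_atTop 0] with t ht
    have := hmono' ht
    simp only [h0, id] at this ⊢
    linarith
  have hbot : Tendsto (position f q) atBot atBot := by
    refine tendsto_atBot_mono' _ ?_ (tendsto_id.const_mul_atBot hm.1)
    filter_upwards [eventually_le_atBot 0] with t ht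
    have := hmono' ht
    simp only [h0, id] at this ⊢
    linarith
  set e := hmono.orderIsoOfSurjective _ (hcont.surjective htop hbot) with he
  have hpi := position_pi (f := f) q
  have hinv : ∀ t, e.symm (position f q t) = t := fun t => e.symm_apply_apply t
  refine ⟨e.symm, ?_, ?_, ?_, hinv, fun x => ?_⟩
  · have := hinv 0
    rwa [h0] at this
  · rw [← hpi, hinv]
  · rw [← hpi, ← h0]
    exact hmono.monotone Real.pi_pos.le
  · exact HasDerivAt.of_local_left_inverse e.symm.continuous.continuousAt (hder _)
      (density_pos hq _).ne' (Eventually.of_forall fun y => e.apply_symm_apply y)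

/-- The reflection `θ ↦ π - θ` preserves `sin² θ` and exchanges the rising and falling halves of the
wave. -/
theorem moment_eq_two_mul (n : ℕ) (hf : ContDiff ℝ 2 f) {q : ℝ × ℝ × ℝ} (hq : q ∈ admissible f) :
    moment n f q = 2 * ∫ t in (0 : ℝ)..(Real.pi / 2), height q t ^ n * density f q t := by
  have hc : Continuous fun t => height q t ^ n * density f q t :=
    ((continuous_height q).pow n).mul (continuous_density hf hq)
  have hsymm := intervalIntegral.integral_comp_sub_left (a := 0) (b := Real.pi / 2)
    (fun t => height q t ^ n * density f q t) Real.pi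
  have hp : Real.pi - Real.pi / 2 = Real.pi / 2 := by ring
  simp only [sub_zero, hp, height, density, Real.sin_pi_sub] at hsymm
  have hadd := intervalIntegral.integral_add_adjacent_intervals
    (hc.intervalIntegrable (μ := volume) 0 (Real.pi / 2))
    (hc.intervalIntegrable (μ := volume) (Real.pi / 2) Real.pi)
  unfold moment
  rw [← hadd]
  simp only [height, density]
  rw [← hsymm]
  ring

/-- The moments of the wave as singular integrals over its range. -/
theorem two_mul_integral_eq_moment (n : ℕ) (hf : ContDiff ℝ 2 f)
    (hF : ∀ v, HasDerivAt F (f v) v) {a E c r s : ℝ} (hq : (r, s, c) ∈ admissible f)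
    (hr : potential F a c r = E) (hs : potential F a c s = E) :
    2 * ∫ v in r..s, v ^ n / √(2 * (E - potential F a c v)) = moment n f (r, s, c) := by
  have hrs : r < s := (mem_admissible_iff.1 hq).1
  have hd : 0 < s - r := sub_pos.2 hrs
  have hpi := Real.pi_pos
  have hsin : ∀ t ∈ Ioo 0 (Real.pi / 2), 0 < Real.sin (2 * t) := fun t ht =>
    Real.sin_pos_of_pos_of_lt_pi (by linarith [ht.1]) (by linarith [ht.2])
  have hmono : StrictMonoOn (height (r, s, c)) (Icc 0 (Real.pi / 2)) := by
    refine strictMonoOn_of_deriv_pos (convex_Icc _ _) (continuous_height _).continuousOn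
      fun t ht => ?_
    rw [interior_Icc] at ht
    rw [(hasDerivAt_height _ t).deriv]
    exact mul_pos hd (hsin t ht)
  have h0 : height (r, s, c) 0 = r := height_zero _
  have h1 : height (r, s, c) (Real.pi / 2) = s := by simp [height]
  have hmem0 : (0 : ℝ) ∈ Icc 0 (Real.pi / 2) := left_mem_Icc.2 (by positivity)
  have hmem1 : Real.pi / 2 ∈ Icc 0 (Real.pi / 2) := right_mem_Icc.2 (by positivity)
  have himage : height (r, s, c) '' Ioo 0 (Real.pi / 2) = Ioo r s := by
    refine Subset.antisymm ?_ ?_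
    · rintro _ ⟨t, ht, rfl⟩
      have htm := Ioo_subset_Icc_self ht
      refine ⟨?_, ?_⟩
      · exact h0.symm.trans_lt (hmono hmem0 htm ht.1)
      · exact (hmono htm hmem1 ht.2).trans_eq h1
    · have := intermediate_value_Ioo (by positivity : (0 : ℝ) ≤ Real.pi / 2)
        (continuous_height (r, s, c)).continuousOn
      rwa [h0, h1] at this
  rw [moment_eq_two_mul n hf hq, intervalIntegral.integral_of_le hrs.le,
    integral_Ioc_eq_integral_Ioo, ← himage,
    integral_image_eq_integral_abs_deriv_smul measurableSet_Ioo
      (fun t _ => (hasDerivAt_height (r, s, c) t).hasDerivWithinAt)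
      (hmono.injOn.mono Ioo_subset_Icc_self),
    intervalIntegral.integral_of_le (by positivity), integral_Ioc_eq_integral_Ioo]
  congr 1
  refine setIntegral_congr_fun measurableSet_Ioo fun t ht => ?_
  have hg := gap_pos hq t
  have hpos : 0 < (s - r) * Real.sin (2 * t) := mul_pos hd (hsin t ht)
  have key := sub_potential hf hF hrs hr hs (Real.sin t ^ 2)
  have e1 : 2 * (E - potential F a c (height (r, s, c) t)) =
      ((s - r) * Real.sin (2 * t)) ^ 2 * (gap f (Real.sin t ^ 2) (r, s, c) / 2) := by
    unfold height
    rw [key, mul_pow, sin_two_mul_sq]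
    ring
  simp only [smul_eq_mul]
  rw [e1, Real.sqrt_mul (sq_nonneg _), Real.sqrt_sq hpos.le, abs_of_pos hpos]
  have : 0 < √(gap f (Real.sin t ^ 2) (r, s, c) / 2) := by positivity
  have hsin' := (hsin t ht).ne'
  unfold density
  field_simp

/-! ### Turning points as functions of `(a, E, c)` -/

/-- A continuous branch of simple roots of `V(· ; a, c) = E` is differentiable. -/
theorem hasFDerivAt_root (hF : ∀ v, HasDerivAt F (f v) v)
    {ρ : ℝ × ℝ × ℝ → ℝ} {p : ℝ × ℝ × ℝ} (hρ : ContinuousAt ρ p)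
    (hroot : ∀ᶠ p in 𝓝 p, potential F p.1 p.2.2 (ρ p) = p.2.1)
    (hsimple : deriv (potential F p.1 p.2.2) (ρ p) ≠ 0) :
    ∃ φ : ℝ × ℝ × ℝ →L[ℝ] ℝ, HasFDerivAt ρ φ p ∧ ∀ v, deriv (potential F p.1 p.2.2) (ρ p) * φ v =
      v.2.1 + ρ p * v.1 + ρ p ^ 2 / 2 * v.2.2 := by
  set κ := deriv (potential F p.1 p.2.2) (ρ p) with hκ
  have hκ' : κ = f (ρ p) - p.2.2 * ρ p - p.1 := (hasDerivAt_potential hF _ _ _).deriv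
  set r := ρ p
  -- This is the derivative of `(w, a, c) ↦ (a, V(w; a, c), c)`, invertible since `κ ≠ 0`. The map
  -- `p ↦ (ρ p, a, c)` is a continuous local section of it, hence differentiable with the inverse
  -- derivative.
  let e : (ℝ × ℝ × ℝ) ≃ₗ[ℝ] ℝ × ℝ × ℝ :=
    { toFun := fun w => (w.2.1, κ * w.1 - r * w.2.1 - r ^ 2 / 2 * w.2.2, w.2.2)
      map_add' := fun w w' => by
        ext <;> simp
        ring
      map_smul' := fun m w => by
        ext <;> simp
        ring
      invFun := fun v => ((v.2.1 + r * v.1 + r ^ 2 / 2 * v.2.2) / κ, v.1, v.2.2)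
      left_inv := fun w => by
        ext <;> simp
        field_simp
        ring
      right_inv := fun v => by
        ext <;> simp
        field_simp
        ring }
  let L : (ℝ × ℝ × ℝ) ≃L[ℝ] ℝ × ℝ × ℝ := e.toContinuousLinearEquiv
  have hG : HasFDerivAt
      (fun w : ℝ × ℝ × ℝ => (w.2.1, potential F w.2.1 w.2.2 w.1, w.2.2))
      (L : (ℝ × ℝ × ℝ) →L[ℝ] ℝ × ℝ × ℝ) (r, p.1, p.2.2) := by
    have h1 : HasFDerivAt (fun w : ℝ × ℝ × ℝ => w.1) (ContinuousLinearMap.fst ℝ ℝ (ℝ × ℝ))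
      (r, p.1, p.2.2) := hasFDerivAt_fst
    have h2 : HasFDerivAt (fun w : ℝ × ℝ × ℝ => w.2.1) ((ContinuousLinearMap.fst ℝ ℝ ℝ).comp
      (ContinuousLinearMap.snd ℝ ℝ (ℝ × ℝ))) (r, p.1, p.2.2) :=
      hasFDerivAt_fst.comp _ hasFDerivAt_snd
    have h3 : HasFDerivAt (fun w : ℝ × ℝ × ℝ => w.2.2) ((ContinuousLinearMap.snd ℝ ℝ ℝ).comp
      (ContinuousLinearMap.snd ℝ ℝ (ℝ × ℝ))) (r, p.1, p.2.2) :=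
      hasFDerivAt_snd.comp _ hasFDerivAt_snd
    have h4 : HasFDerivAt (fun w : ℝ × ℝ × ℝ => potential F w.2.1 w.2.2 w.1) _ (r, p.1, p.2.2) :=
      (((hF r).comp_hasFDerivAt (r, p.1, p.2.2) h1).sub
        ((h3.mul_const 2⁻¹).mul (h1.pow 2))).sub (h2.mul h1)
    refine (h2.prodMk (h4.prodMk h3)).congr_fderiv ?_
    ext <;> simp [L, e, hκ'] <;> ring
  have hg : ContinuousAt (fun p : ℝ × ℝ × ℝ => (ρ p, p.1, p.2.2)) p := by
    refine hρ.prodMk ?_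
    fun_prop
  have hinv := HasFDerivAt.of_local_left_inverse (g := fun p : ℝ × ℝ × ℝ => (ρ p, p.1, p.2.2))
    (f' := L) hg hG (by
      filter_upwards [hroot] with p hp
      rw [hp])
  have hcomp : HasFDerivAt ρ ((ContinuousLinearMap.fst ℝ ℝ (ℝ × ℝ)).comp
      (L.symm : (ℝ × ℝ × ℝ) →L[ℝ] ℝ × ℝ × ℝ)) p :=
    hinv.fst
  refine ⟨_, hcomp, fun v => ?_⟩
  change κ * ((v.2.1 + r * v.1 + r ^ 2 / 2 * v.2.2) / κ) = _
  field_simp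

namespace IsWaveRegion

variable {D : Set (ℝ × ℝ × ℝ)} {uMinus uPlus : ℝ → ℝ → ℝ → ℝ}

/-- The turning points as a function of the parameters `(a, E, c)`. -/
def turning (uMinus uPlus : ℝ → ℝ → ℝ → ℝ) (p : ℝ × ℝ × ℝ) : ℝ × ℝ × ℝ :=
  (uMinus p.1 p.2.1 p.2.2, uPlus p.1 p.2.1 p.2.2, p.2.2)

theorem turning_mem (hD : IsWaveRegion F D uMinus uPlus) (hf : ContDiff ℝ 2 f)
    (hF : ∀ v, HasDerivAt F (f v) v) {p : ℝ × ℝ × ℝ} (hp : p ∈ D) :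
    turning uMinus uPlus p ∈ admissible f :=
  mem_admissible hf hF (hD.lt _ _ _ hp) (hD.root_minus _ _ _ hp) (hD.root_plus _ _ _ hp)
    (hD.below _ _ _ hp) (hD.simple_minus _ _ _ hp) (hD.simple_plus _ _ _ hp)

theorem level_turning (hD : IsWaveRegion F D uMinus uPlus) {p : ℝ × ℝ × ℝ} (hp : p ∈ D) :
    level F (turning uMinus uPlus p) = p.1 :=
  level_eq (E := p.2.1) (hD.lt _ _ _ hp) (hD.root_minus _ _ _ hp) (hD.root_plus _ _ _ hp)

theorem period_eq (hD : IsWaveRegion F D uMinus uPlus) (hf : ContDiff ℝ 2 f)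
    (hF : ∀ v, HasDerivAt F (f v) v) {p : ℝ × ℝ × ℝ} (hp : p ∈ D) :
    period F uMinus uPlus p.1 p.2.1 p.2.2 = moment 0 f (turning uMinus uPlus p) := by
  have h := two_mul_integral_eq_moment 0 hf hF (hD.turning_mem hf hF hp)
    (hD.root_minus _ _ _ hp) (hD.root_plus _ _ _ hp)
  simp only [pow_zero] at h
  exact h

theorem mass_eq (hD : IsWaveRegion F D uMinus uPlus) (hf : ContDiff ℝ 2 f)
    (hF : ∀ v, HasDerivAt F (f v) v) {p : ℝ × ℝ × ℝ} (hp : p ∈ D) :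
    mass F uMinus uPlus p.1 p.2.1 p.2.2 = moment 1 f (turning uMinus uPlus p) := by
  have h := two_mul_integral_eq_moment 1 hf hF (hD.turning_mem hf hF hp)
    (hD.root_minus _ _ _ hp) (hD.root_plus _ _ _ hp)
  simp only [pow_one] at h
  exact h

theorem momentum_eq (hD : IsWaveRegion F D uMinus uPlus) (hf : ContDiff ℝ 2 f)
    (hF : ∀ v, HasDerivAt F (f v) v) {p : ℝ × ℝ × ℝ} (hp : p ∈ D) :
    momentum F uMinus uPlus p.1 p.2.1 p.2.2 = moment 2 f (turning uMinus uPlus p) :=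
  two_mul_integral_eq_moment 2 hf hF (hD.turning_mem hf hF hp)
    (hD.root_minus _ _ _ hp) (hD.root_plus _ _ _ hp)

/-- Differentiability of the turning points in the parameters. -/
theorem hasFDerivAt_turning (hD : IsWaveRegion F D uMinus uPlus) (hf : ContDiff ℝ 2 f)
    (hF : ∀ v, HasDerivAt F (f v) v) {p : ℝ × ℝ × ℝ} (hp : p ∈ D) :
    ∃ φ : ℝ × ℝ × ℝ →L[ℝ] ℝ × ℝ × ℝ, HasFDerivAt (turning uMinus uPlus) φ p ∧
      ∀ v, deriv (potential F p.1 p.2.2) (uMinus p.1 p.2.1 p.2.2) * (φ v).1 =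
          v.2.1 + uMinus p.1 p.2.1 p.2.2 * v.1 + uMinus p.1 p.2.1 p.2.2 ^ 2 / 2 * v.2.2 ∧
        (φ v).2.2 = v.2.2 ∧ fderiv ℝ (level F) (turning uMinus uPlus p) (φ v) = v.1 := by
  have hmem := hD.isOpen.eventually_mem hp
  obtain ⟨φ₁, h1, h1v⟩ := hasFDerivAt_root (ρ := fun p => uMinus p.1 p.2.1 p.2.2) hF
    (hD.continuousOn_minus.continuousAt (hD.isOpen.mem_nhds hp))
    (hmem.mono fun p hp => hD.root_minus _ _ _ hp) (hD.simple_minus _ _ _ hp)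
  obtain ⟨φ₂, h2, -⟩ := hasFDerivAt_root (ρ := fun p => uPlus p.1 p.2.1 p.2.2) hF
    (hD.continuousOn_plus.continuousAt (hD.isOpen.mem_nhds hp))
    (hmem.mono fun p hp => hD.root_plus _ _ _ hp) (hD.simple_plus _ _ _ hp)
  have h3 : HasFDerivAt (fun p : ℝ × ℝ × ℝ => p.2.2) ((ContinuousLinearMap.snd ℝ ℝ ℝ).comp
    (ContinuousLinearMap.snd ℝ ℝ (ℝ × ℝ))) p := hasFDerivAt_snd.comp p hasFDerivAt_snd
  have hturn : HasFDerivAt (turning uMinus uPlus) (φ₁.prod (φ₂.prod ((ContinuousLinearMap.snd ℝ ℝ ℝ).comp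
    (ContinuousLinearMap.snd ℝ ℝ (ℝ × ℝ))))) p := h1.prodMk (h2.prodMk h3)
  refine ⟨_, hturn, fun v => ⟨h1v v, by simp, ?_⟩⟩
  have hlev := ((contDiffOn_level hf hF).differentiableOn one_ne_zero).differentiableAt
    ((isOpen_admissible hf).mem_nhds (hD.turning_mem hf hF hp)) |>.hasFDerivAt
  have h4 := hlev.comp p hturn
  -- On all of `D` the level of the turning points is the parameter `a`; the chain rule turns this
  -- into the value of the derivative of `level`.
  have h5 := (hasFDerivAt_fst (𝕜 := ℝ) (p := p)).congr_of_eventuallyEq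
    (f₁ := level F ∘ turning uMinus uPlus) (hmem.mono fun p hp => hD.level_turning hp)
  exact congrArg (fun ψ : ℝ × ℝ × ℝ →L[ℝ] ℝ => ψ v) (h4.unique h5)

end IsWaveRegion

/-! ### The profile in phase coordinates, and its variations -/

/-- Uniqueness for the profile equation. -/
theorem profile_unique (hf : ContDiff ℝ 2 f) {a c L : ℝ} {u u' w w' : ℝ → ℝ}
    (hu : ∀ x, HasDerivAt u (u' x) x) (hu' : ∀ x, HasDerivAt u' (a + c * u x - f (u x)) x)
    (hw : ∀ x, HasDerivAt w (w' x) x) (hw' : ∀ x, HasDerivAt w' (a + c * w x - f (w x)) x)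
    (h0 : u 0 = w 0) (h0' : u' 0 = w' 0) : ∀ x ∈ Icc 0 L, u x = w x ∧ u' x = w' x := by
  have hc : ∀ {g g' : ℝ → ℝ}, (∀ x, HasDerivAt g (g' x) x) → Continuous g := fun h =>
    continuous_iff_continuousAt.2 fun x => (h x).continuousAt
  have c1 : Continuous fun x => (u x, u' x) := (hc hu).prodMk (hc hu')
  have c2 : Continuous fun x => (w x, w' x) := (hc hw).prodMk (hc hw')
  obtain ⟨B₁, hB₁⟩ := (isCompact_Icc (a := 0) (b := L)).exists_bound_of_continuousOn c1.continuousOn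
  obtain ⟨B₂, hB₂⟩ := (isCompact_Icc (a := 0) (b := L)).exists_bound_of_continuousOn c2.continuousOn
  have hf1 : ContDiff ℝ 1 f := hf.of_le one_le_two
  have hV : ContDiff ℝ 1 fun z : ℝ × ℝ => (z.2, a + c * z.1 - f z.1) := by fun_prop
  -- On `[0, L]` both solutions stay in one closed ball, on which the `C¹` vector field is
  -- Lipschitz.
  obtain ⟨K, hK⟩ := hV.contDiffOn.exists_lipschitzOnWith one_ne_zero
    (convex_closedBall (0 : ℝ × ℝ) (max B₁ B₂)) (isCompact_closedBall _ _)
  have key := ODE_solution_unique_of_mem_Icc_right (v := fun _ z => (z.2, a + c * z.1 - f z.1))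
    (s := fun _ => Metric.closedBall (0 : ℝ × ℝ) (max B₁ B₂)) (K := K) (a := 0) (b := L)
    (f := fun x => (u x, u' x)) (g := fun x => (w x, w' x)) (fun _ _ => hK) c1.continuousOn
    (fun x _ => ((hu x).prodMk (hu' x)).hasDerivWithinAt)
    (fun x hx => by
      rw [mem_closedBall_zero_iff]
      exact (hB₁ x (Ico_subset_Icc_self hx)).trans (le_max_left _ _)) c2.continuousOn
    (fun x _ => ((hw x).prodMk (hw' x)).hasDerivWithinAt)
    (fun x hx => by
      rw [mem_closedBall_zero_iff]
      exact (hB₂ x (Ico_subset_Icc_self hx)).trans (le_max_right _ _)) (by simp [h0, h0'])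
  exact fun x hx => Prod.ext_iff.1 (key hx)

namespace IsWaveProfile

variable {a c r : ℝ} {u : ℝ → ℝ} {q : ℝ × ℝ × ℝ}

theorem hasDerivAt (hu : IsWaveProfile f a c r u) (x : ℝ) : HasDerivAt u (deriv u x) x :=
  (hu.differentiable x).hasDerivAt

theorem hasDerivAt_deriv (hu : IsWaveProfile f a c r u) (x : ℝ) :
    HasDerivAt (deriv u) (a + c * u x - f (u x)) x :=
  (hu.differentiable_deriv x).hasDerivAt.congr_deriv (by linarith [hu.equation x])

theorem hasDerivAt_deriv_comp (hu : IsWaveProfile f a c r u) (hf : ContDiff ℝ 2 f) (x : ℝ) :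
    HasDerivAt (fun x => deriv f (u x)) (deriv (deriv f) (u x) * deriv u x) x :=
  (((contDiff_deriv hf).differentiable one_ne_zero (u x)).hasDerivAt).comp x (hu.hasDerivAt x)

theorem continuous_linearization (hu : IsWaveProfile f a c r u) (hf : ContDiff ℝ 2 f) :
    Continuous fun x => deriv f (u x) - c :=
  ((contDiff_deriv hf).continuous.comp hu.differentiable.continuous).sub continuous_const

/-- The profile in phase coordinates. -/
theorem eq_height (hf : ContDiff ℝ 2 f) (hF : ∀ v, HasDerivAt F (f v) v) (hq : q ∈ admissible f)
    (hu : IsWaveProfile f (level F q) q.2.2 q.1 u) {Θ : ℝ → ℝ} (h0 : Θ 0 = 0)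
    (hΘ : ∀ x, HasDerivAt Θ (density f q (Θ x))⁻¹ x) (L : ℝ) :
    ∀ x ∈ Icc 0 L, u x = height q (Θ x) ∧ deriv u x = speed f q (Θ x) := by
  have hne := fun x => (density_pos hq (Θ x)).ne'
  refine profile_unique hf hu.hasDerivAt hu.hasDerivAt_deriv (fun x => ?_) (fun x => ?_) ?_ ?_
  · refine ((hasDerivAt_height q (Θ x)).comp x (hΘ x)).congr_deriv ?_
    rw [← speed_mul_density hq, mul_inv_cancel_right₀ (hne x)]
  · refine ((hasDerivAt_speed hf hF hq (Θ x)).comp x (hΘ x)).congr_deriv ?_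
    rw [mul_inv_cancel_right₀ (hne x)]
    rfl
  · rw [hu.init, h0, height_zero]
  · rw [hu.init_deriv, h0, speed_zero]

/-- The profile performs one oscillation over a period. -/
theorem isOscillation (hf : ContDiff ℝ 2 f) (hF : ∀ v, HasDerivAt F (f v) v)
    (hq : q ∈ admissible f) (hu : IsWaveProfile f (level F q) q.2.2 q.1 u)
    (hκ : deriv (potential F (level F q) q.2.2) q.1 ≠ 0) :
    IsOscillation (fun x => deriv f (u x) - q.2.2) u (moment 0 f q) q.1
      (deriv (potential F (level F q) q.2.2) q.1) (deriv u)
      (fun x => level F q + q.2.2 * u x - f (u x)) := by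
  obtain ⟨Θ, h0, hL, hpos, -, hΘ⟩ := exists_phase hf hq
  obtain ⟨e1, e2⟩ := hu.eq_height hf hF hq h0 hΘ (moment 0 f q) _ (right_mem_Icc.2 hpos)
  rw [hL, height_pi] at e1
  rw [hL, speed_pi] at e2
  have hκ' := (hasDerivAt_potential hF (level F q) q.2.2 q.1).deriv
  refine ⟨hpos, (hu.continuous_linearization hf).continuousOn, fun x _ => hu.hasDerivAt x,
    fun x _ => hu.hasDerivAt_deriv x, fun x _ => ?_, hu.init, e1, hu.init_deriv, e2, ?_, ?_, hκ⟩
  · have h1 := hu.hasDerivAt x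
    exact (((h1.const_mul q.2.2).const_add (level F q)).sub
      ((hasDerivAt_of_contDiff hf (u x)).comp x h1)).congr_deriv (by ring)
  · rw [hu.init, hκ']
    ring
  · rw [e1, hκ']
    ring

/-- The derivative of the wave along a change of its turning points. -/
theorem exists_isVariation (hf : ContDiff ℝ 2 f) (hF : ∀ v, HasDerivAt F (f v) v)
    (hq : q ∈ admissible f) (hu : IsWaveProfile f (level F q) q.2.2 q.1 u) (v : ℝ × ℝ × ℝ) :
    ∃ y y' : ℝ → ℝ, IsVariation (fun x => deriv f (u x) - q.2.2) u (moment 0 f q)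
      (fderiv ℝ (level F) q v) v.2.2 v.1
      (deriv (potential F (level F q) q.2.2) q.1 * fderiv ℝ (moment 0 f) q v)
      (fderiv ℝ (moment 1 f) q v - q.1 * fderiv ℝ (moment 0 f) q v)
      ((fderiv ℝ (moment 2 f) q v - q.1 ^ 2 * fderiv ℝ (moment 0 f) q v) / 2) y y' := by
  obtain ⟨Θ, h0, hL, hpos, hinv, hΘ⟩ := exists_phase hf hq
  have hprof := hu.eq_height hf hF hq h0 hΘ (moment 0 f q)
  have hne := fun x => (density_pos hq (Θ x)).ne'
  have hcΘ : Continuous Θ := continuous_iff_continuousAt.2 fun x => (hΘ x).continuousAt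
  have hcy : Continuous (variation f q v) :=
    continuous_iff_continuousAt.2 fun t => (hasDerivAt_variation hf hF hq v t).continuousAt
  -- The slope vanishes at phases `0` and `π` for every choice of turning points, so the slope jump
  -- of the variation comes entirely from the change of period.
  have hspeed0 : ∀ t, (∀ q, speed f q t = 0) → dSpeed f q v t = 0 := fun t ht => by
    unfold dSpeed
    simp [ht]
  have hint : ∀ n : ℕ, ∫ x in (0 : ℝ)..(moment 0 f q), height q (Θ x) ^ n * variation f q v (Θ x) =
      ∫ t in (0 : ℝ)..Real.pi, height q t ^ n * variation f q v t * density f q t := by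
    intro n
    have h1 := intervalIntegral.integral_comp_mul_deriv (a := 0) (b := Real.pi)
      (f := position f q) (f' := density f q)
      (g := fun x => height q (Θ x) ^ n * variation f q v (Θ x))
      (fun t _ => hasDerivAt_position hf hq t) (continuous_density hf hq).continuousOn
      ((((continuous_height q).comp hcΘ).pow n).mul (hcy.comp hcΘ))
    rw [position_zero, position_pi] at h1
    rw [← h1]
    simp only [Function.comp_apply, hinv]
  refine ⟨fun x => variation f q v (Θ x), fun x => variationSlope f F q v (Θ x), fun x _ => ?_,
    fun x hx => ?_, ?_, ?_, ?_, ?_, ?_, ?_⟩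
  · refine ((hasDerivAt_variation hf hF hq v (Θ x)).comp x (hΘ x)).congr_deriv ?_
    have := hne x
    field_simp
  · refine ((hasDerivAt_variationSlope hf hF hq v (Θ x)).comp x (hΘ x)).congr_deriv ?_
    rw [(hprof x hx).1]
    have := hne x
    field_simp
  · rw [h0, variation, speed_zero, height_zero, zero_mul, sub_zero]
  · rw [h0, variationSlope, hspeed0 0 speed_zero, dPosition, intervalIntegral.integral_same,
      mul_zero, sub_zero]
  · rw [hL, variation, speed_pi, height_pi, zero_mul, sub_zero]
  · rw [hL, variationSlope, hspeed0 _ speed_pi, fderiv_moment_zero hf hq, force, height_pi,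
      (hasDerivAt_potential hF _ _ _).deriv]
    ring
  · have h1 := integral_variation 0 hf hq v
    rw [← hint] at h1
    simp only [pow_zero, one_mul, Nat.cast_zero, zero_add, pow_one] at h1
    exact h1
  · have h1 := integral_variation 1 hf hq v
    rw [← hint] at h1
    simp only [pow_one, Nat.cast_one, one_add_one_eq_two] at h1
    rw [← h1, mul_div_cancel_left₀ _ two_ne_zero]
    refine intervalIntegral.integral_congr fun x hx => ?_
    rw [uIcc_of_le hpos] at hx
    rw [(hprof x hx).1]

end IsWaveProfile

/-! ### Reduction of the first order system and of the partial derivatives -/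

/-- The change of variables between `(v, v', v'')` and `(v, v', -v'' - k v)`, an involution. -/
def reduction (k : ℝ) : Matrix (Fin 3) (Fin 3) ℂ := !![1, 0, 0; 0, 1, 0; -k, 0, -1]

theorem reduction_mul_self (k : ℝ) : reduction k * reduction k = 1 := by
  ext i j
  fin_cases i <;> fin_cases j <;> simp [reduction, Matrix.mul_apply, Fin.sum_univ_three]

/-- The fundamental matrix of the first order system in reduced variables. -/
theorem IsFundamentalMatrix.isFundamentalSystem {c : ℝ} {u : ℝ → ℝ} {μ : ℂ}
    {Φ : ℝ → Matrix (Fin 3) (Fin 3) ℂ} (hΦ : IsFundamentalMatrix (coeffMatrix f c u μ) Φ)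
    (hu : ∀ x, HasDerivAt (fun x => deriv f (u x) - c) (deriv (deriv f) (u x) * deriv u x) x)
    (L : ℝ) :
    IsFundamentalSystem (fun x => deriv f (u x) - c) L μ fun j x i =>
      (reduction (deriv f (u x) - c) * Φ x * reduction (deriv f (u 0) - c)) i j := by
  set R := reduction (deriv f (u 0) - c) with hR
  have hd : ∀ x i j, HasDerivAt (fun y => (Φ y * R) i j)
      ((coeffMatrix f c u μ x * (Φ x * R)) i j) x := by
    intro x i j
    rw [← mul_assoc]
    have e : ∀ X : Matrix (Fin 3) (Fin 3) ℂ, (X * R) i j = ∑ l, X i l * R l j := fun X =>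
      Matrix.mul_apply
    simp only [e]
    exact HasDerivAt.fun_sum fun l _ => (hΦ.2 x i l).mul_const (R l j)
  have e0 : ∀ x j, (reduction (deriv f (u x) - c) * Φ x * R) 0 j = (Φ x * R) 0 j := by
    intro x j
    rw [mul_assoc]
    simp [reduction, Matrix.mul_apply, Fin.sum_univ_three]
  have e1 : ∀ x j, (reduction (deriv f (u x) - c) * Φ x * R) 1 j = (Φ x * R) 1 j := by
    intro x j
    rw [mul_assoc]
    simp [reduction, Matrix.mul_apply, Fin.sum_univ_three]
  have e2 : ∀ x j, (reduction (deriv f (u x) - c) * Φ x * R) 2 j =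
      -((deriv f (u x) - c : ℝ) : ℂ) * (Φ x * R) 0 j - (Φ x * R) 2 j := by
    intro x j
    rw [mul_assoc, Matrix.mul_apply, Fin.sum_univ_three]
    simp [reduction]
    ring
  have hm : ∀ x i j, (coeffMatrix f c u μ x * (Φ x * R)) i j =
      ∑ l, coeffMatrix f c u μ x i l * (Φ x * R) l j := fun x i j => Matrix.mul_apply
  refine ⟨fun j => IsForcedSolution.of_components ?_ ?_ ?_, ?_⟩
  · intro x _
    simp only [e0, e1]
    refine (hd x 0 j).congr_deriv ?_
    rw [hm, Fin.sum_univ_three]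
    simp [coeffMatrix]
  · intro x _
    simp only [e0, e1, e2]
    refine (hd x 1 j).congr_deriv ?_
    rw [hm, Fin.sum_univ_three]
    simp [coeffMatrix]
    ring
  · intro x _
    simp only [e0, e2]
    refine (((hu x).ofReal_comp.neg.mul (hd x 0 j)).sub (hd x 2 j)).congr_deriv ?_
    simp only [hm, Fin.sum_univ_three]
    simp [coeffMatrix]
    ring
  · change reduction (deriv f (u 0) - c) * Φ 0 * R = 1
    rw [hΦ.1, mul_one, hR, reduction_mul_self]

theorem partial_eq {g : ℝ → ℝ → ℝ → ℝ} {a E c : ℝ} {φ : ℝ × ℝ × ℝ →L[ℝ] ℝ}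
    (h : HasFDerivAt (fun p : ℝ × ℝ × ℝ => g p.1 p.2.1 p.2.2) φ (a, E, c)) :
    partialA g a E c = φ (1, 0, 0) ∧ partialE g a E c = φ (0, 1, 0) ∧
      partialC g a E c = φ (0, 0, 1) := by
  have h1 : HasDerivAt (fun s : ℝ => (s, E, c)) (1, 0, 0) a :=
    (hasDerivAt_id a).prodMk ((hasDerivAt_const a E).prodMk (hasDerivAt_const a c))
  have h2 : HasDerivAt (fun s : ℝ => (a, s, c)) (0, 1, 0) E :=
    (hasDerivAt_const E a).prodMk ((hasDerivAt_id E).prodMk (hasDerivAt_const E c))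
  have h3 : HasDerivAt (fun s : ℝ => (a, E, s)) (0, 0, 1) c :=
    (hasDerivAt_const c a).prodMk ((hasDerivAt_const c E).prodMk (hasDerivAt_id c))
  have d1 : HasDerivAt (fun s => g s E c) (φ (1, 0, 0)) a :=
    HasFDerivAt.comp_hasDerivAt_of_eq a h h1 rfl
  have d2 : HasDerivAt (fun s => g a s c) (φ (0, 1, 0)) E :=
    HasFDerivAt.comp_hasDerivAt_of_eq E h h2 rfl
  have d3 : HasDerivAt (fun s => g a E s) (φ (0, 0, 1)) c :=
    HasFDerivAt.comp_hasDerivAt_of_eq c h h3 rfl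
  exact ⟨d1.deriv, d2.deriv, d3.deriv⟩

theorem trace_derivAtZero {N : ℂ → Matrix (Fin 3) (Fin 3) ℂ}
    (hN : ∀ i j, AnalyticAt ℂ (fun μ => N μ i j) 0) (k : ℕ) :
    (derivAtZero k N).trace = iteratedDeriv k (fun μ => (N μ).trace) 0 := by
  simp only [Matrix.trace, Matrix.diag]
  rw [iteratedDeriv_fun_sum fun i _ => (hN i i).contDiffAt]
  rfl

/-- A function which is a moment of the wave is differentiable in the parameters. -/
theorem IsWaveRegion.hasFDerivAt_of_eq_moment {D : Set (ℝ × ℝ × ℝ)}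
    {uMinus uPlus : ℝ → ℝ → ℝ → ℝ} (hD : IsWaveRegion F D uMinus uPlus) (hf : ContDiff ℝ 2 f)
    (hF : ∀ v, HasDerivAt F (f v) v) {p : ℝ × ℝ × ℝ} (hp : p ∈ D) (n : ℕ) {g : ℝ × ℝ × ℝ → ℝ}
    (hg : ∀ p ∈ D, g p = moment n f (turning uMinus uPlus p))
    {φ : ℝ × ℝ × ℝ →L[ℝ] ℝ × ℝ × ℝ} (hφ : HasFDerivAt (turning uMinus uPlus) φ p) :
    HasFDerivAt g ((fderiv ℝ (moment n f) (turning uMinus uPlus p)).comp φ) p :=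
  ((differentiableAt_moment n hf (hD.turning_mem hf hF hp)).hasFDerivAt.comp p
    hφ).congr_of_eventuallyEq ((hD.isOpen.eventually_mem hp).mono hg)

end GKdV

/-! ### Assembly -/

open GKdV
theorem mainTheorem2 (f F : ℝ → ℝ) (hf : ContDiff ℝ 2 f) (hF : ∀ v, HasDerivAt F (f v) v)
    (D : Set (ℝ × ℝ × ℝ)) (uMinus uPlus : ℝ → ℝ → ℝ → ℝ)
    (hD : IsWaveRegion F D uMinus uPlus)
    (T M P : ℝ → ℝ → ℝ → ℝ)
    (hT : T = period F uMinus uPlus) (hM : M = mass F uMinus uPlus)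
    (hP : P = momentum F uMinus uPlus)
    (a E c : ℝ) (hp : (a, E, c) ∈ D)
    (u : ℝ → ℝ) (hu : IsWaveProfile f a c (uMinus a E c) u)
    (Mono : ℂ → Matrix (Fin 3) (Fin 3) ℂ) (hMono : IsMonodromy f c u (T a E c) Mono) :
    -- the derivatives that occur below exist
    DifferentiableAt ℝ (fun p : ℝ × ℝ × ℝ => T p.1 p.2.1 p.2.2) (a, E, c) ∧
    DifferentiableAt ℝ (fun p : ℝ × ℝ × ℝ => M p.1 p.2.1 p.2.2) (a, E, c) ∧
    DifferentiableAt ℝ (fun p : ℝ × ℝ × ℝ => P p.1 p.2.1 p.2.2) (a, E, c) ∧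
    (∀ i j, AnalyticAt ℂ (fun μ => Mono μ i j) 0) ∧
    -- the trace identities
    (derivAtZero 2 Mono).trace =
      ((jacobian₂ partialE partialC T P a E c
        + 2 * jacobian₂ partialA partialE M P a E c : ℝ) : ℂ) ∧
    (derivAtZero 3 Mono).trace =
      ((-(3 / 2) * jacobian₃ partialA partialE partialC T M P a E c : ℝ) : ℂ) ∧
    -- the modulational stability index
    modulationalIndex Mono =
      ((1 / 2 * (jacobian₂ partialE partialC T P a E c
            + 2 * jacobian₂ partialA partialE M P a E c) ^ 3
        - 3 * (3 / 2 * jacobian₃ partialA partialE partialC T M P a E c) ^ 2 : ℝ) : ℂ) := by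
  have hTm : ∀ p ∈ D, T p.1 p.2.1 p.2.2 = moment 0 f (IsWaveRegion.turning uMinus uPlus p) := by
    rw [hT]
    exact fun p hp => hD.period_eq hf hF hp
  have hMm : ∀ p ∈ D, M p.1 p.2.1 p.2.2 = moment 1 f (IsWaveRegion.turning uMinus uPlus p) := by
    rw [hM]
    exact fun p hp => hD.mass_eq hf hF hp
  have hPm : ∀ p ∈ D, P p.1 p.2.1 p.2.2 = moment 2 f (IsWaveRegion.turning uMinus uPlus p) := by
    rw [hP]
    exact fun p hp => hD.momentum_eq hf hF hp
  obtain ⟨φ, hφ, hφv⟩ := hD.hasFDerivAt_turning hf hF hp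
  have dT := hD.hasFDerivAt_of_eq_moment hf hF hp 0 hTm hφ
  have dM := hD.hasFDerivAt_of_eq_moment hf hF hp 1 hMm hφ
  have dP := hD.hasFDerivAt_of_eq_moment hf hF hp 2 hPm hφ
  have hq := hD.turning_mem hf hF hp
  have hlev : level F (IsWaveRegion.turning uMinus uPlus (a, E, c)) = a := hD.level_turning hp
  have hTL : T a E c = moment 0 f (IsWaveRegion.turning uMinus uPlus (a, E, c)) := hTm _ hp
  have hsimple := hD.simple_minus _ _ _ hp
  have hq1 : (IsWaveRegion.turning uMinus uPlus (a, E, c)).1 = uMinus a E c := rfl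
  have hq2 : (IsWaveRegion.turning uMinus uPlus (a, E, c)).2.2 = c := rfl
  set q := IsWaveRegion.turning uMinus uPlus (a, E, c) with hqdef
  simp only at hφv
  obtain ⟨r, hr⟩ : ∃ r, uMinus a E c = r := ⟨_, rfl⟩
  rw [hr] at hu hsimple hφv hq1
  obtain ⟨κ, hκ⟩ : ∃ κ, deriv (potential F a c) r = κ := ⟨_, rfl⟩
  have hu' : IsWaveProfile f (level F q) q.2.2 q.1 u := by rwa [hlev, hq2, hq1]
  have hosc := hu'.isOscillation hf hF hq (by rwa [hlev, hq2, hq1])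
  have hvar := fun v => hu'.exists_isVariation hf hF hq (φ v)
  simp only [hlev, hq2, hq1, hκ] at hosc hvar
  rw [hκ] at hsimple
  simp only [hκ] at hφv
  obtain ⟨ya, ya', ha⟩ := hvar (1, 0, 0)
  obtain ⟨ye, ye', he⟩ := hvar (0, 1, 0)
  obtain ⟨yc, yc', hc⟩ := hvar (0, 0, 1)
  obtain ⟨Ta, Te, Tc⟩ := partial_eq dT
  obtain ⟨Ma, Me, Mc⟩ := partial_eq dM
  obtain ⟨Pa, Pe, Pc⟩ := partial_eq dP
  simp only [ContinuousLinearMap.comp_apply] at Ta Te Tc Ma Me Mc Pa Pe Pc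
  have hρ : ∀ v, (φ v).1 = (v.2.1 + r * v.1 + r ^ 2 / 2 * v.2.2) / κ := fun v => by
    rw [← (hφv v).1, mul_div_cancel_left₀ _ hsimple]
  simp only [(hφv _).2.1, (hφv _).2.2, hρ, ← Ta, ← Te, ← Tc, ← Ma, ← Me, ← Mc, ← Pa, ← Pe,
    ← Pc] at ha he hc
  rw [show (0 + r * 1 + r ^ 2 / 2 * 0) / κ = r / κ by ring] at ha
  rw [show (1 + r * 0 + r ^ 2 / 2 * 0) / κ = 1 / κ by ring] at he
  rw [show (0 + r * 0 + r ^ 2 / 2 * 1) / κ = r ^ 2 / (2 * κ) by field_simp; ring] at hc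
  -- the symmetry relations between the derivatives
  have cu := hosc.continuousOn_self
  have s1 : partialE M a E c = partialA T a E c := by
    have := ha.wronskian hosc.nonneg cu he
    field_simp at this
    linarith
  have s2 : partialE P a E c = 2 * partialC T a E c := by
    have := hc.wronskian hosc.nonneg cu he
    field_simp at this
    linarith
  have s3 : partialA P a E c = 2 * partialC M a E c := by
    have := hc.wronskian hosc.nonneg cu ha
    field_simp at this
    linarith
  -- the monodromy in reduced variables
  choose Φ hΦ hMΦ using hMono
  have hk : ∀ x, HasDerivAt (fun x => deriv f (u x) - c) (deriv (deriv f) (u x) * deriv u x) x :=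
    fun x => (hu.hasDerivAt_deriv_comp hf x).sub_const c
  have hsys := fun μ => (hΦ μ).isFundamentalSystem hk (moment 0 f q)
  obtain ⟨hdiff, htr⟩ := hosc.iteratedDeriv_trace ha he hc hsys
  -- The change of variables depends on `x` only through `u x`, so it is the same involution `R` at
  -- both ends; the reduced monodromy is a conjugate of `Mono μ` and has the same trace.
  have hend : u (T a E c) = u 0 := by rw [hTL, hosc.right, hosc.left]
  set R := reduction (deriv f (u 0) - c) with hR
  have hRR : R * R = 1 := reduction_mul_self _
  have hcol : ∀ μ, columnMatrix (fun j x i => (reduction (deriv f (u x) - c) * Φ μ x * R) i j)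
      (moment 0 f q) = R * Mono μ * R := by
    intro μ
    ext i j
    rw [hMΦ, ← hTL]
    simp only [columnMatrix, Matrix.of_apply]
    rw [hend]
  have hMono' : ∀ μ, Mono μ = R * (R * Mono μ * R) * R := fun μ => by
    simp only [← mul_assoc]
    rw [hRR, one_mul, mul_assoc, hRR, mul_one]
  have htrace : ∀ μ, (R * Mono μ * R).trace = (Mono μ).trace := fun μ => by
    rw [Matrix.trace_mul_comm, ← mul_assoc, hRR, one_mul]
  simp only [hcol, htrace] at hdiff htr
  have han : ∀ i j, AnalyticAt ℂ (fun μ => Mono μ i j) 0 := by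
    intro i j
    refine Differentiable.analyticAt ?_ 0
    have h1 : (fun μ => Mono μ i j) = fun μ => ∑ l, (∑ m, R i m * (R * Mono μ * R) m l) * R l j := by
      funext μ
      conv_lhs => rw [hMono' μ]
      rw [Matrix.mul_apply]
      have e : ∀ l, (R * (R * Mono μ * R)) i l = ∑ m, R i m * (R * Mono μ * R) m l :=
        fun l => Matrix.mul_apply
      simp only [e]
    rw [h1]
    exact Differentiable.fun_sum fun l _ =>
      (Differentiable.fun_sum fun m _ => (hdiff m l).const_mul _).mul_const _
  obtain ⟨t2, t3⟩ := htr _ rfl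
  have h2 : (derivAtZero 2 Mono).trace = ((jacobian₂ partialE partialC T P a E c
        + 2 * jacobian₂ partialA partialE M P a E c : ℝ) : ℂ) := by
    rw [trace_derivAtZero han, t2]
    congr 1
    -- The symmetry relations eliminate `M_E`, `P_E` and `P_a`; after that `r` and `κ` cancel.
    simp only [jacobian₂, Matrix.det_fin_two_of, Matrix.trace_fin_three,
      Matrix.adjugate_fin_three_of, Matrix.of_apply, Matrix.cons_val, s1, s2, s3]
    field_simp
    ring
  have h3 : (derivAtZero 3 Mono).trace =
      ((-(3 / 2) * jacobian₃ partialA partialE partialC T M P a E c : ℝ) : ℂ) := by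
    rw [trace_derivAtZero han, t3]
    congr 1
    -- Up to transposition, row and column operations and scalings, the limit matrix is the Jacobian
    -- matrix of `(T, M, P)`; the `1 / 2` in `3 / 2` comes from `∫ u y` being half of a derivative
    -- of `P`, up to a period term.
    simp only [jacobian₃, Matrix.det_fin_three, Matrix.of_apply, Matrix.cons_val, s1, s2, s3]
    field_simp
    ring
  refine ⟨dT.differentiableAt, dM.differentiableAt, dP.differentiableAt, han, h2, h3, ?_⟩
  rw [modulationalIndex, h2, h3]
  push_cast
  ring
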